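/- Let $d\ge 0$ be an integer, let $\mathbb T^d=\mathbb R^d/\mathbb Z^d$ be the flat torus, let $T>0$, $\nu>0$, $\varepsilon>0$, $\xi\in\mathbb T^d$, and let $A\subset(0,T)\times\mathbb T^d$ be a (Lebesgue) measurable set. Let $$H=\{v\in L^2((0,T),H^1(\mathbb T^d)) : \partial_t v\in L^2((0,T),H^{-1}(\mathbb T^d))\},$$ where $H^{-1}(\mathbb T^d)$ is the dual of $H^1(\mathbb T^d)$, and recall that every $v\in H$ has a representative in $C([0,T],L^2(\mathbb T^d))$, through which $v(0)$ is defined. Then for every $m_0\in L^2(\mathbb T^d)$ with $m_0\ge 0$ almost everywhere there exists a unique $m\in H$ such that $$\partial_t m-\nu\Delta m+\frac1\varepsilon\,\mathbb 1_A(t,x)\,m(t,x)-\frac1\varepsilon\,\mathbb 1_A(t,x-\xi)\,m(t,x-\xi)=0\quad\text{in }(0,T)\times\mathbb T^d$$ in the sense of distributions, and $m(0)=m_0$ in $\mathbb T^d$. Moreover $m\ge 0$ almost everywhere in $(0,T)\times\mathbb T^d$. -/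

import Mathlib

open MeasureTheory Set
open scoped ContDiff ENNReal

noncomputable section

namespace JumpFP

/-- The `d`-dimensional flat torus `ℝ^d / ℤ^d`, with its Lebesgue (probability) measure. -/
abbrev Torus (d : ℕ) : Type := UnitAddTorus (Fin d)

/-- The quotient map `ℝ^d → ℝ^d / ℤ^d`. -/
def proj {d : ℕ} (y : Fin d → ℝ) : Torus d := fun i => (y i : UnitAddCircle)

/-- The partial derivative `∂_i g (x)` of a function on the torus. -/
def partialDeriv {d : ℕ} (i : Fin d) (g : Torus d → ℝ) (x : Torus d) : ℝ :=
  deriv (fun s : ℝ => g (x + Pi.single i (s : UnitAddCircle))) 0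

/-- The Laplacian `∑ i, ∂_i ∂_i g` of a function on the torus. -/
def laplacian {d : ℕ} (g : Torus d → ℝ) (x : Torus d) : ℝ :=
  ∑ i : Fin d, partialDeriv i (partialDeriv i g) x

/-- `g ∈ C^∞(T^d)`: the periodic lift of `g` to `ℝ^d` is smooth. -/
def SmoothOnTorus {d : ℕ} (g : Torus d → ℝ) : Prop :=
  ContDiff ℝ ∞ (fun y : Fin d → ℝ => g (proj y))

/-- `θ ∈ C_c^∞((0,T))`. -/
def IsTimeTest (T : ℝ) (θ : ℝ → ℝ) : Prop :=
  ContDiff ℝ ∞ θ ∧ HasCompactSupport θ ∧ tsupport θ ⊆ Ioo 0 T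

/-- `φ ∈ C_c^∞((0,T) × T^d)`. -/
def IsTest {d : ℕ} (T : ℝ) (φ : ℝ × Torus d → ℝ) : Prop :=
  ContDiff ℝ ∞ (fun p : ℝ × (Fin d → ℝ) => φ (p.1, proj p.2)) ∧
    HasCompactSupport φ ∧ tsupport φ ⊆ Ioo 0 T ×ˢ univ

/-- `L²(T^d)`. -/
abbrev L2 (d : ℕ) : Type := Lp ℝ 2 (volume : Measure (Torus d))

/-- `g` is the weak partial derivative `∂_i u`, for `u, g ∈ L²(T^d)`. -/
def IsWeakPartial {d : ℕ} (i : Fin d) (u g : L2 d) : Prop :=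
  ∀ φ : Torus d → ℝ, SmoothOnTorus φ →
    ∫ x, u x * partialDeriv i φ x = - ∫ x, g x * φ x

lemma proj_isOpenQuotientMap (d : ℕ) : IsOpenQuotientMap (proj : (Fin d → ℝ) → Torus d) :=
  IsOpenQuotientMap.piMap (f := fun (_ : Fin d) (s : ℝ) => (s : UnitAddCircle))
    (fun _ => QuotientAddGroup.isOpenQuotientMap_mk)

lemma SmoothOnTorus.continuous {d : ℕ} {g : Torus d → ℝ} (hg : SmoothOnTorus g) :
    Continuous g :=
  (proj_isOpenQuotientMap d).isQuotientMap.continuous_iff.2 (ContDiff.continuous hg)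

lemma partialDeriv_proj {d : ℕ} {g : Torus d → ℝ} (hg : SmoothOnTorus g) (i : Fin d)
    (y : Fin d → ℝ) :
    partialDeriv i g (proj y) =
      fderiv ℝ (fun z : Fin d → ℝ => g (proj z)) y (Pi.single i 1) := by
  have h1 : ∀ s : ℝ, g (proj y + Pi.single i (s : UnitAddCircle)) =
      (fun z : Fin d → ℝ => g (proj z)) (y + s • Pi.single i (1 : ℝ)) := by
    intro s
    have : (proj y + Pi.single i (s : UnitAddCircle) : Torus d) =
        proj (y + s • Pi.single i (1 : ℝ)) := by
      funext j
      by_cases hj : j = i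
      · subst hj; simp [proj]
      · simp [proj, hj]
    simp only [this]
  have hd : DifferentiableAt ℝ (fun z : Fin d → ℝ => g (proj z)) y :=
    (ContDiff.differentiable hg (by simp)) y
  unfold partialDeriv
  simp only [h1]
  exact hd.lineDeriv_eq_fderiv

lemma SmoothOnTorus.partialDeriv_smooth {d : ℕ} {g : Torus d → ℝ} (hg : SmoothOnTorus g)
    (i : Fin d) : SmoothOnTorus (partialDeriv i g) := by
  unfold SmoothOnTorus
  simp only [partialDeriv_proj hg]
  exact (ContDiff.fderiv_right (m := ∞) hg (by simp)).clm_apply contDiff_const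

lemma integrable_mul_of_continuous {d : ℕ} (u : L2 d) {g : Torus d → ℝ} (hg : Continuous g) :
    Integrable (fun x => u x * g x) := by
  have hg2 : MemLp g 2 (volume : Measure (Torus d)) :=
    hg.memLp_of_hasCompactSupport (HasCompactSupport.of_compactSpace g)
  exact (Lp.memLp u).integrable_mul hg2

/-- The Sobolev space `H¹(T^d)`: the pairs `(u, ∇u)` with `u ∈ L²` having a weak gradient
`∇u ∈ L²`, with the Hilbert norm `‖u‖² + ∑ i, ‖∂_i u‖²`.  (The second component is determined
by the first, so this is the usual space of functions.) -/
def H1 (d : ℕ) : Submodule ℝ (WithLp 2 (L2 d × PiLp 2 (fun _ : Fin d => L2 d))) where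
  carrier := {p | ∀ i : Fin d, IsWeakPartial i p.fst (p.snd i)}
  zero_mem' := by
    intro i φ hφ
    have h : ∀ᵐ x : Torus d, (0 : L2 d) x = 0 := Lp.coeFn_zero ℝ 2 volume
    have e : ∀ f : Torus d → ℝ, ∫ x, (0 : L2 d) x * f x = 0 := fun f =>
      integral_eq_zero_of_ae (by filter_upwards [h] with x hx; rw [hx, zero_mul, Pi.zero_apply])
    change ∫ x, (0 : L2 d) x * partialDeriv i φ x = -∫ x, (0 : L2 d) x * φ x
    rw [e, e, neg_zero]
  add_mem' := by
    intro p q hp hq i φ hφ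
    have e : ∀ (u v : L2 d) (f : Torus d → ℝ), Continuous f →
        ∫ x, (u + v) x * f x = (∫ x, u x * f x) + ∫ x, v x * f x := by
      intro u v f hf
      rw [← integral_add (integrable_mul_of_continuous u hf) (integrable_mul_of_continuous v hf)]
      refine integral_congr_ae ?_
      filter_upwards [Lp.coeFn_add u v] with x hx
      rw [hx, Pi.add_apply, add_mul]
    have h1 := hp i φ hφ
    have h2 := hq i φ hφ
    have h3 := e p.fst q.fst _ (hφ.partialDeriv_smooth i).continuous
    have h4 := e (p.snd i) (q.snd i) _ hφ.continuous
    change ∫ x, (p.fst + q.fst) x * partialDeriv i φ x = -∫ x, (p.snd i + q.snd i) x * φ x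
    linarith
  smul_mem' := by
    intro c p hp i φ hφ
    have e : ∀ (u : L2 d) (f : Torus d → ℝ),
        ∫ x, (c • u) x * f x = c * ∫ x, u x * f x := by
      intro u f
      rw [← integral_const_mul]
      refine integral_congr_ae ?_
      filter_upwards [Lp.coeFn_smul c u] with x hx
      rw [hx, Pi.smul_apply, smul_eq_mul, mul_assoc]
    have h1 := hp i φ hφ
    change ∫ x, (c • p.fst) x * partialDeriv i φ x = -∫ x, (c • p.snd i) x * φ x
    rw [e, e, h1]
    ring

/-- The inclusion `H¹(T^d) → L²(T^d)`. -/
def toL2 (d : ℕ) : H1 d →L[ℝ] L2 d :=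
  (WithLp.fstL 2 ℝ (L2 d) (PiLp 2 (fun _ : Fin d => L2 d))).comp (H1 d).subtypeL

/-- `H⁻¹(T^d)`, the dual of `H¹(T^d)`. -/
abbrev Hneg1 (d : ℕ) : Type := StrongDual ℝ (H1 d)

/-- The embedding `H¹(T^d) → L²(T^d) → H⁻¹(T^d)`, `u ↦ (z ↦ ∫ u z)`. -/
def toHneg1 {d : ℕ} (u : H1 d) : Hneg1 d := (innerSL ℝ (toL2 d u)).comp (toL2 d)

/-- Lebesgue measure on the time interval `(0,T)`. -/
abbrev timeMeasure (T : ℝ) : Measure ℝ := volume.restrict (Ioo 0 T)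

/-- The Bochner space `L²((0,T), X)`. -/
abbrev L2Time (T : ℝ) (X : Type*) [NormedAddCommGroup X] : Type _ := Lp X 2 (timeMeasure T)

/-- `w = ∂_t v` weakly on `(0,T)`, in the sense of `H⁻¹(T^d)`-valued distributions. -/
def IsWeakTimeDeriv {d : ℕ} {T : ℝ} (v : L2Time T (H1 d)) (w : L2Time T (Hneg1 d)) : Prop :=
  ∀ θ : ℝ → ℝ, IsTimeTest T θ →
    ∫ t, deriv θ t • toHneg1 (v t) ∂(timeMeasure T) = - ∫ t, θ t • w t ∂(timeMeasure T)

/-- The space `H = {v ∈ L²((0,T), H¹(T^d)) : ∂_t v ∈ L²((0,T), H⁻¹(T^d))}`. -/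
def parabolicSpace (d : ℕ) (T : ℝ) : Set (L2Time T (H1 d)) :=
  {v | ∃ w : L2Time T (Hneg1 d), IsWeakTimeDeriv v w}

/-- `m(0) = m₀`: the value at time `0` of the continuous representative `[0,T] → L²(T^d)`
of `m` is `m₀`. -/
def HasInitialValue {d : ℕ} {T : ℝ} (m : L2Time T (H1 d)) (m₀ : L2 d) : Prop :=
  ∃ c : ℝ → L2 d, ContinuousOn c (Icc 0 T) ∧
    (∀ᵐ t ∂(timeMeasure T), c t = toL2 d (m t)) ∧ c 0 = m₀

/-- The function `1_A`. -/
def ind {d : ℕ} (A : Set (ℝ × Torus d)) (t : ℝ) (x : Torus d) : ℝ :=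
  A.indicator (fun _ => (1 : ℝ)) (t, x)

/-- `∂_t m - ν Δ m + ε⁻¹ 1_A m - ε⁻¹ (1_A m)(t, x - ξ) = 0` in the sense of distributions on
`(0,T) × T^d`. -/
def SolvesPenalized {d : ℕ} {T : ℝ} (ν ε : ℝ) (ξ : Torus d) (A : Set (ℝ × Torus d))
    (m : L2Time T (H1 d)) : Prop :=
  ∀ φ : ℝ × Torus d → ℝ, IsTest T φ →
    ∫ t in Ioo 0 T, ∫ x : Torus d,
      (toL2 d (m t) x * (-(deriv (fun s => φ (s, x)) t) - ν * laplacian (fun z => φ (t, z)) x)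
        + ε⁻¹ * (ind A t x * toL2 d (m t) x) * φ (t, x)
        - ε⁻¹ * (ind A t (x - ξ) * toL2 d (m t) (x - ξ)) * φ (t, x)) = 0

/-- `m ∈ H` solves the penalized Fokker-Planck equation with `m(0) = m₀`. -/
def IsPenalizedSolution {d : ℕ} {T : ℝ} (ν ε : ℝ) (ξ : Torus d) (A : Set (ℝ × Torus d))
    (m₀ : L2 d) (m : L2Time T (H1 d)) : Prop :=
  m ∈ parabolicSpace d T ∧ SolvesPenalized ν ε ξ A m ∧ HasInitialValue m m₀

end JumpFP

end

/-!
The equation is `∂_t m = νΔm + B m - β m` with `β = ε⁻¹`, where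
`B u = β (1 - 1_A) u + β (1_A u)(· - ξ)` is a positive operator on `L²(T^d)` that depends on time
(`jump`) and is bounded by `3β`.

The heat semigroup is the average of the translations of the torus over a Gaussian
(`heat`).  It is therefore a positive contraction, and on the real Fourier basis of functions
`cas (2π k·x) = cos (2π k·x) + sin (2π k·x)` (`hartley`) it acts as multiplication by `e^{-tλ_k}`.
With an additional damping `κ = 4β`, which replaces `m` by `e^{-3βt} m`, Duhamel's formula defines
a contraction of `C([0,T], L²)` for the sup norm (`picard`), and it preserves the closed cone of
nonnegative functions.  Hence it has a unique fixed point, which is nonnegative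
(`exists_unique_picard`).

It remains to identify the fixed points with the solutions.  For a continuous curve `c` in `L²`,
Duhamel's formula is equivalent to the linear ordinary differential equations satisfied by the
coordinates of `c` (`eq_picard_iff`).  Multiplying each of them by the coordinate itself and
summing over the modes gives the energy estimate, so that `c` lies in `L²((0,T), H¹)`, and its
weak time derivative `νΔc + B c - β c` lies in `L²((0,T), H⁻¹)` (`SolvesModes.summable`,
`SolvesModes.mem_parabolicSpace`).  The equation in the sense of distributions follows by
expanding a test function in the basis (`SolvesModes.integral_test`).  Conversely, testing with
the products `θ(t) cas_k(x)` and the lemma of du Bois-Reymond recover the equations of the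
coordinates (`solvesModes_of_integral_test`), so every solution comes from the fixed point: the
solution is unique, and it inherits the sign of the fixed point.
-/

open MeasureTheory Set Filter Topology
open scoped ContDiff ENNReal

noncomputable section

namespace JumpFP

/-! ### Calculus on the torus -/

instance (d : ℕ) : IsProbabilityMeasure (volume : Measure (Torus d)) := by
  have : IsProbabilityMeasure (volume : Measure UnitAddCircle) := ⟨UnitAddCircle.measure_univ⟩
  exact inferInstanceAs (IsProbabilityMeasure (Measure.pi fun _ : Fin d => volume))

lemma proj_surjective (d : ℕ) : Function.Surjective (proj : (Fin d → ℝ) → Torus d) :=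
  (proj_isOpenQuotientMap d).surjective

lemma continuous_proj (d : ℕ) : Continuous (proj : (Fin d → ℝ) → Torus d) :=
  (proj_isOpenQuotientMap d).continuous

lemma proj_add {d : ℕ} (y z : Fin d → ℝ) : (proj (y + z) : Torus d) = proj y + proj z := by
  funext i; simp [proj]

lemma proj_single {d : ℕ} (i : Fin d) (s : ℝ) :
    (proj (s • Pi.single i (1 : ℝ)) : Torus d) = Pi.single i (s : UnitAddCircle) := by
  funext j
  by_cases hj : j = i
  · subst hj; simp [proj]
  · simp [proj, hj]

lemma SmoothOnTorus.hasDerivAt_line {d : ℕ} {g : Torus d → ℝ} (hg : SmoothOnTorus g) (i : Fin d)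
    (x : Torus d) (s : ℝ) :
    HasDerivAt (fun s : ℝ => g (x + Pi.single i (s : UnitAddCircle)))
      (partialDeriv i g (x + Pi.single i (s : UnitAddCircle))) s := by
  obtain ⟨y, rfl⟩ := proj_surjective d x
  have h1 : ∀ s : ℝ, (proj y + Pi.single i (s : UnitAddCircle) : Torus d) =
      proj (y + s • Pi.single i (1 : ℝ)) := by
    intro s; rw [proj_add, proj_single]
  simp only [h1]
  rw [partialDeriv_proj hg]
  have hd := ((ContDiff.differentiable hg (by simp)) (y + s • Pi.single i (1 : ℝ))).hasFDerivAt
  have hl : HasDerivAt (fun s : ℝ => y + s • (Pi.single i (1 : ℝ) : Fin d → ℝ))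
      (Pi.single i (1 : ℝ)) s := by
    simpa using ((hasDerivAt_id s).smul_const (Pi.single i (1 : ℝ) : Fin d → ℝ)).const_add y
  exact hd.comp_hasDerivAt s hl

lemma SmoothOnTorus.hasDerivAt_zero {d : ℕ} {g : Torus d → ℝ} (hg : SmoothOnTorus g) (i : Fin d)
    (x : Torus d) :
    HasDerivAt (fun s : ℝ => g (x + Pi.single i (s : UnitAddCircle))) (partialDeriv i g x) 0 := by
  simpa [Pi.single_zero] using hg.hasDerivAt_line i x 0

lemma SmoothOnTorus.mul {d : ℕ} {f g : Torus d → ℝ} (hf : SmoothOnTorus f)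
    (hg : SmoothOnTorus g) : SmoothOnTorus (fun x => f x * g x) :=
  ContDiff.mul hf hg

lemma partialDeriv_mul {d : ℕ} {f g : Torus d → ℝ} (hf : SmoothOnTorus f)
    (hg : SmoothOnTorus g) (i : Fin d) (x : Torus d) :
    partialDeriv i (fun x => f x * g x) x = partialDeriv i f x * g x + f x * partialDeriv i g x := by
  have := ((hf.hasDerivAt_zero i x).fun_mul (hg.hasDerivAt_zero i x)).deriv
  simpa [partialDeriv, Pi.single_zero] using this

lemma integrable_of_continuous {d : ℕ} {g : Torus d → ℝ} (hg : Continuous g) : Integrable g :=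
  hg.integrable_of_hasCompactSupport (HasCompactSupport.of_compactSpace g)

lemma exists_bound_of_continuous {X : Type*} [TopologicalSpace X] [CompactSpace X] {g : X → ℝ}
    (hg : Continuous g) : ∃ C, ∀ x, ‖g x‖ ≤ C := by
  obtain ⟨C, hC⟩ := isCompact_univ.exists_bound_of_continuousOn hg.continuousOn
  exact ⟨C, fun x => hC x (mem_univ x)⟩

lemma hasDerivAt_integral_torus {d : ℕ} {F F' : ℝ → Torus d → ℝ} (hF : ∀ s, Continuous (F s))
    (hF' : ∀ s, Continuous (F' s)) {C : ℝ} (hC : ∀ s x, ‖F' s x‖ ≤ C)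
    (h : ∀ s x, HasDerivAt (fun s => F s x) (F' s x) s) (s₀ : ℝ) :
    HasDerivAt (fun s => ∫ x, F s x) (∫ x, F' s₀ x) s₀ :=
  (hasDerivAt_integral_of_dominated_loc_of_deriv_le (s := univ) (bound := fun _ => C) univ_mem
    (Eventually.of_forall fun s => (hF s).aestronglyMeasurable)
    (integrable_of_continuous (hF s₀)) (hF' s₀).aestronglyMeasurable
    (Eventually.of_forall fun x s _ => hC s x) (integrable_const C)
    (Eventually.of_forall fun x s _ => h s x)).2

/-- By translation invariance `s ↦ ∫ g (x + s e_i)` is constant, so its derivative at `0`, which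
is `∫ ∂_i g`, vanishes. -/
lemma integral_partialDeriv {d : ℕ} {g : Torus d → ℝ} (hg : SmoothOnTorus g) (i : Fin d) :
    ∫ x, partialDeriv i g x = 0 := by
  have hg' := (hg.partialDeriv_smooth i).continuous
  obtain ⟨C, hC⟩ := exists_bound_of_continuous hg'
  have h := hasDerivAt_integral_torus
    (F := fun (s : ℝ) x => g (x + Pi.single i (s : UnitAddCircle)))
    (fun s => hg.continuous.comp (continuous_add_const _))
    (fun s => hg'.comp (continuous_add_const _))
    (fun s x => hC _) (fun s x => hg.hasDerivAt_line i x s) 0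
  have e : ∀ (f : Torus d → ℝ) (z : Torus d), ∫ x, f (x + z) = ∫ x, f x :=
    fun f z => integral_add_right_eq_self f z
  simp only [Function.comp_apply, e] at h
  exact h.unique (hasDerivAt_const (0 : ℝ) (∫ x : Torus d, g x))

lemma integral_mul_partialDeriv {d : ℕ} {f g : Torus d → ℝ} (hf : SmoothOnTorus f)
    (hg : SmoothOnTorus g) (i : Fin d) :
    ∫ x, f x * partialDeriv i g x = - ∫ x, partialDeriv i f x * g x := by
  have h := integral_partialDeriv (hf.mul hg) i
  simp only [partialDeriv_mul hf hg] at h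
  rw [integral_add] at h
  · linarith
  · exact integrable_of_continuous ((hf.partialDeriv_smooth i).continuous.mul hg.continuous)
  · exact integrable_of_continuous (hf.continuous.mul (hg.partialDeriv_smooth i).continuous)

lemma integral_mul_laplacian {d : ℕ} {f g : Torus d → ℝ} (hf : SmoothOnTorus f)
    (hg : SmoothOnTorus g) :
    ∫ x, f x * laplacian g x = ∫ x, laplacian f x * g x := by
  have e1 : ∀ x, f x * laplacian g x = ∑ i, f x * partialDeriv i (partialDeriv i g) x :=
    fun x => by rw [laplacian, Finset.mul_sum]
  have e2 : ∀ x, laplacian f x * g x = ∑ i, partialDeriv i (partialDeriv i f) x * g x :=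
    fun x => by rw [laplacian, Finset.sum_mul]
  simp only [e1, e2]
  rw [integral_finsetSum, integral_finsetSum]
  · refine Finset.sum_congr rfl fun i _ => ?_
    rw [integral_mul_partialDeriv hf (hg.partialDeriv_smooth i),
      integral_mul_partialDeriv (hf.partialDeriv_smooth i) hg, neg_neg]
  · intro i _
    exact integrable_of_continuous
      (((hf.partialDeriv_smooth i).partialDeriv_smooth i).continuous.mul hg.continuous)
  · intro i _
    exact integrable_of_continuous
      (hf.continuous.mul ((hg.partialDeriv_smooth i).partialDeriv_smooth i).continuous)

/-! ### The Hartley basis of real `L²` of the torus -/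

/-- The phase `2π k · y`. -/
def phase {d : ℕ} (k : Fin d → ℤ) (y : Fin d → ℝ) : ℝ := ∑ i, 2 * Real.pi * k i * y i

lemma phase_add {d : ℕ} (k : Fin d → ℤ) (y z : Fin d → ℝ) :
    phase k (y + z) = phase k y + phase k z := by
  simp [phase, mul_add, Finset.sum_add_distrib]

lemma phase_smul {d : ℕ} (k : Fin d → ℤ) (s : ℝ) (y : Fin d → ℝ) :
    phase k (s • y) = s * phase k y := by
  simp only [phase, Finset.mul_sum, Pi.smul_apply, smul_eq_mul]
  exact Finset.sum_congr rfl fun i _ => by ring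

lemma phase_single {d : ℕ} (k : Fin d → ℤ) (i : Fin d) :
    phase k (Pi.single i 1) = 2 * Real.pi * k i := by
  rw [phase, Finset.sum_eq_single i]
  · simp
  · intro j _ hj; simp [hj]
  · simp

lemma phase_neg {d : ℕ} (k : Fin d → ℤ) (y : Fin d → ℝ) : phase (-k) y = -phase k y := by
  simp [phase]

lemma phase_index_add {d : ℕ} (k l : Fin d → ℤ) (y : Fin d → ℝ) :
    phase (k + l) y = phase k y + phase l y := by
  simp only [phase, ← Finset.sum_add_distrib, Pi.add_apply]
  exact Finset.sum_congr rfl fun i _ => by push_cast; ring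

lemma phase_contDiff {d : ℕ} (k : Fin d → ℤ) : ContDiff ℝ ∞ (phase k) := by
  unfold phase; fun_prop

/-- The Hartley function `cos (2π k · x) + sin (2π k · x)`.  These real functions, indexed by the
same lattice `ℤ^d` as the complex exponentials, form an orthonormal basis of real `L²`. -/
def cas {d : ℕ} (k : Fin d → ℤ) (x : Torus d) : ℝ :=
  (UnitAddTorus.mFourier k x).re + (UnitAddTorus.mFourier k x).im

lemma mFourier_proj {d : ℕ} (k : Fin d → ℤ) (y : Fin d → ℝ) :
    UnitAddTorus.mFourier k (proj y : Torus d) = Complex.exp ((phase k y : ℝ) * Complex.I) := by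
  simp only [UnitAddTorus.mFourier, proj, ContinuousMap.coe_mk, fourier_coe_apply,
    ← Complex.exp_sum, phase]
  congr 1
  push_cast
  rw [Finset.sum_mul]
  refine Finset.sum_congr rfl fun i _ => ?_
  ring

lemma cas_proj {d : ℕ} (k : Fin d → ℤ) (y : Fin d → ℝ) :
    cas k (proj y : Torus d) = Real.cos (phase k y) + Real.sin (phase k y) := by
  rw [cas, mFourier_proj, Complex.exp_ofReal_mul_I_re, Complex.exp_ofReal_mul_I_im]

lemma cas_smooth {d : ℕ} (k : Fin d → ℤ) : SmoothOnTorus (cas k : Torus d → ℝ) := by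
  unfold SmoothOnTorus
  simp only [cas_proj]
  exact (phase_contDiff k).cos.add (phase_contDiff k).sin

/-- The translates of `cas k` are combinations of `cas k` and `cas (-k)`; derivatives,
orthogonality and the action of translations on the basis all follow from this addition formula. -/
lemma cas_add_proj {d : ℕ} (k : Fin d → ℤ) (x : Torus d) (z : Fin d → ℝ) :
    cas k (x + proj z) = Real.cos (phase k z) * cas k x + Real.sin (phase k z) * cas (-k) x := by
  obtain ⟨y, rfl⟩ := proj_surjective d x
  rw [← proj_add, cas_proj, cas_proj, cas_proj, phase_add, phase_neg, Real.cos_add, Real.sin_add,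
    Real.cos_neg, Real.sin_neg]
  ring

lemma partialDeriv_cas {d : ℕ} (i : Fin d) (k : Fin d → ℤ) :
    partialDeriv i (cas k : Torus d → ℝ) = fun x => 2 * Real.pi * k i * cas (-k) x := by
  funext x
  have h : ∀ s : ℝ, cas k (x + Pi.single i (s : UnitAddCircle)) =
      Real.cos (s * (2 * Real.pi * k i)) * cas k x +
        Real.sin (s * (2 * Real.pi * k i)) * cas (-k) x := by
    intro s
    rw [← proj_single, cas_add_proj, phase_smul, phase_single]
  unfold partialDeriv
  simp only [h]
  have h1 : HasDerivAt (fun s : ℝ => s * (2 * Real.pi * k i)) (2 * Real.pi * k i) 0 := by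
    simpa using (hasDerivAt_id (0 : ℝ)).mul_const (2 * Real.pi * (k i : ℝ))
  have := ((h1.cos.mul_const (cas k x)).fun_add (h1.sin.mul_const (cas (-k) x))).deriv
  simpa using this

/-- The eigenvalue `4π² |k|²` of `-Δ` at the Hartley function `cas k`. -/
def eigenvalue {d : ℕ} (k : Fin d → ℤ) : ℝ := ∑ i, (2 * Real.pi * k i) ^ 2

lemma eigenvalue_nonneg {d : ℕ} (k : Fin d → ℤ) : 0 ≤ eigenvalue k :=
  Finset.sum_nonneg fun _ _ => sq_nonneg _

lemma partialDeriv_const_mul {d : ℕ} (i : Fin d) (c : ℝ) (g : Torus d → ℝ) :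
    partialDeriv i (fun x => c * g x) = fun x => c * partialDeriv i g x := by
  funext x
  simp [partialDeriv]

lemma laplacian_cas {d : ℕ} (k : Fin d → ℤ) (x : Torus d) :
    laplacian (cas k) x = - eigenvalue k * cas k x := by
  simp only [laplacian, partialDeriv_cas, partialDeriv_const_mul, neg_neg, eigenvalue,
    Pi.neg_apply, neg_mul, Finset.sum_mul, ← Finset.sum_neg_distrib]
  refine Finset.sum_congr rfl fun i _ => ?_
  push_cast; ring

lemma integral_cas {d : ℕ} (k : Fin d → ℤ) :
    ∫ x : Torus d, cas k x = if k = 0 then 1 else 0 := by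
  split_ifs with h
  · subst h
    have : ∀ x : Torus d, cas 0 x = 1 := by
      intro x; simp [cas, UnitAddTorus.mFourier_zero]
    simp [this]
  · obtain ⟨i, hi⟩ := Function.ne_iff.mp h
    -- a translation by half a period in the direction `i` changes the sign of `cas k`
    have hi' : (k i : ℝ) ≠ 0 := by exact_mod_cast hi
    have hph : phase k ((1 / (2 * (k i : ℝ))) • Pi.single i 1) = Real.pi := by
      rw [phase_smul, phase_single]; field_simp
    have h1 := integral_add_right_eq_self (μ := (volume : Measure (Torus d))) (cas k)
      (proj ((1 / (2 * (k i : ℝ))) • Pi.single i 1))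
    simp only [cas_add_proj, hph, Real.cos_pi, Real.sin_pi, zero_mul, add_zero, neg_mul, one_mul,
      integral_neg] at h1
    linarith

lemma cas_mul_cas {d : ℕ} (k l : Fin d → ℤ) (x : Torus d) :
    cas k x * cas l x = (cas (k - l) x + cas (l - k) x + cas (k + l) x - cas (-(k + l)) x) / 2 := by
  obtain ⟨y, rfl⟩ := proj_surjective d x
  simp only [cas_proj, sub_eq_add_neg, phase_index_add, phase_neg, neg_add, Real.cos_add,
    Real.sin_add, Real.cos_neg, Real.sin_neg]
  ring

lemma integral_cas_mul_cas {d : ℕ} (k l : Fin d → ℤ) :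
    ∫ x : Torus d, cas k x * cas l x = if k = l then 1 else 0 := by
  simp only [cas_mul_cas]
  have hc : ∀ n : Fin d → ℤ, Integrable (cas n : Torus d → ℝ) :=
    fun n => integrable_of_continuous (cas_smooth n).continuous
  have e : ∀ a b c e : Fin d → ℤ, ∫ x : Torus d, (cas a x + cas b x + cas c x - cas e x) =
      (∫ x : Torus d, cas a x) + (∫ x : Torus d, cas b x) + (∫ x : Torus d, cas c x) -
        ∫ x : Torus d, cas e x := by
    intro a b c e
    have h2 : Integrable (fun x : Torus d => cas a x + cas b x) volume := (hc a).add (hc b)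
    have h3 : Integrable (fun x : Torus d => cas a x + cas b x + cas c x) volume := h2.add (hc c)
    rw [integral_sub h3 (hc e), integral_add h2 (hc c), integral_add (hc a) (hc b)]
  rw [integral_div, e]
  simp only [integral_cas, sub_eq_zero, neg_eq_zero, eq_comm (a := l)]
  split_ifs <;> norm_num

/-- A continuous function on the torus as an element of `L²`. -/
def contL2 {d : ℕ} (g : Torus d → ℝ) (hg : Continuous g) : L2 d :=
  ContinuousMap.toLp (E := ℝ) 2 volume ℝ ⟨g, hg⟩

lemma contL2_coe {d : ℕ} (g : Torus d → ℝ) (hg : Continuous g) :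
    contL2 g hg =ᵐ[volume] g :=
  ContinuousMap.coeFn_toLp volume ⟨g, hg⟩

lemma inner_contL2 {d : ℕ} (u : L2 d) (g : Torus d → ℝ) (hg : Continuous g) :
    inner ℝ u (contL2 g hg) = ∫ x, u x * g x := by
  rw [L2.inner_def]
  refine integral_congr_ae ?_
  filter_upwards [contL2_coe g hg] with x hx
  rw [hx]; simp [mul_comm]

/-- The Hartley function `cas k` as an element of `L²`. -/
def casL2 {d : ℕ} (k : Fin d → ℤ) : L2 d := contL2 (cas k) (cas_smooth k).continuous

lemma inner_casL2 {d : ℕ} (u : L2 d) (k : Fin d → ℤ) :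
    inner ℝ u (casL2 k) = ∫ x, u x * cas k x := inner_contL2 u _ _

lemma casL2_coe {d : ℕ} (k : Fin d → ℤ) : (casL2 k : L2 d) =ᵐ[volume] cas k := contL2_coe _ _

lemma orthonormal_casL2 (d : ℕ) : Orthonormal ℝ (casL2 : (Fin d → ℤ) → L2 d) := by
  rw [orthonormal_iff_ite]
  intro k l
  rw [inner_casL2, ← integral_cas_mul_cas]
  refine integral_congr_ae ?_
  filter_upwards [casL2_coe k] with x hx
  rw [hx]

/-- Taking real parts maps trigonometric polynomials to combinations of Hartley functions, so the
uniform density of the former gives the totality of the latter. -/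
lemma eq_zero_of_inner_casL2 {d : ℕ} (u : L2 d) (hu : ∀ k, inner ℝ u (casL2 k) = 0) : u = 0 := by
  let K : C(Torus d, ℂ) →L[ℝ] L2 d :=
    (ContinuousMap.toLp (E := ℝ) 2 volume ℝ).comp (Complex.reCLM.compLeftContinuous ℝ (Torus d))
  have hK : ∀ g : C(Torus d, ℂ), inner ℝ u (K g) = ∫ x, u x * (g x).re := fun g =>
    inner_contL2 u (fun x => (g x).re) (Complex.continuous_re.comp g.continuous)
  let P : Submodule ℂ C(Torus d, ℂ) :=
    { carrier := {g | ∀ c : ℂ, inner ℝ u (K (c • g)) = 0}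
      zero_mem' := by intro c; simp
      add_mem' := by intro a b ha hb c
                     have e : K (c • (a + b)) = K (c • a) + K (c • b) := by
                       rw [← map_add]; congr 1; exact smul_add c a b
                     rw [e, inner_add_right, ha, hb, add_zero]
      smul_mem' := by intro a b hb c; rw [smul_smul]; exact hb _ }
  have hPc : IsClosed (P : Set C(Torus d, ℂ)) := by
    have : (P : Set C(Torus d, ℂ)) = ⋂ c : ℂ, {g | inner ℝ u (K (c • g)) = 0} := by
      ext g; simp [P]
    rw [this]
    refine isClosed_iInter fun c => isClosed_eq ?_ continuous_const
    exact continuous_const.inner (K.continuous.comp (continuous_const_smul c))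
  have hPm : ∀ k, UnitAddTorus.mFourier k ∈ P := by
    intro k c
    rw [hK]
    have e : ∀ x : Torus d, (((c • UnitAddTorus.mFourier k : C(Torus d, ℂ)) x).re : ℝ) =
        (c.re - c.im) / 2 * cas k x + (c.re + c.im) / 2 * cas (-k) x := by
      intro x
      simp only [ContinuousMap.smul_apply, smul_eq_mul, Complex.mul_re, cas,
        UnitAddTorus.mFourier_neg, Complex.conj_re, Complex.conj_im]
      ring
    simp only [e, mul_add, mul_left_comm]
    rw [integral_add, integral_const_mul, integral_const_mul, ← inner_casL2, ← inner_casL2, hu, hu]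
    · simp
    · exact (integrable_mul_of_continuous u (cas_smooth k).continuous).const_mul _
    · exact (integrable_mul_of_continuous u (cas_smooth (-k)).continuous).const_mul _
  have hP : P = ⊤ := by
    rw [eq_top_iff, ← UnitAddTorus.span_mFourier_closure_eq_top]
    exact Submodule.topologicalClosure_minimal _
      (Submodule.span_le.2 (by rintro _ ⟨k, rfl⟩; exact hPm k)) hPc
  have hd : DenseRange (ContinuousMap.toLp (E := ℝ) 2 (volume : Measure (Torus d)) ℝ) :=
    ContinuousMap.toLp_denseRange ℝ volume ℝ (by simp)
  refine (hd.induction_on (p := fun v => inner ℝ u v = 0) u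
    (isClosed_eq (continuous_const.inner continuous_id) continuous_const) fun g => ?_)
    |> inner_self_eq_zero.1
  have hg : (⟨fun x => (g x : ℂ), Complex.continuous_ofReal.comp g.continuous⟩ : C(Torus d, ℂ)) ∈ P
    := hP ▸ Submodule.mem_top
  have := hg 1
  rw [one_smul, hK] at this
  rw [← this]
  exact inner_contL2 u g g.continuous

/-- The Hilbert basis of `L²(T^d)` made of the Hartley functions. -/
def hartley (d : ℕ) : HilbertBasis (Fin d → ℤ) ℝ (L2 d) :=
  HilbertBasis.mkOfOrthogonalEqBot (orthonormal_casL2 d) (by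
    rw [Submodule.eq_bot_iff]
    intro u hu
    refine eq_zero_of_inner_casL2 u fun k => ?_
    rw [real_inner_comm]
    exact (Submodule.mem_orthogonal _ _).1 hu _ (Submodule.subset_span ⟨k, rfl⟩))

@[simp] lemma hartley_apply {d : ℕ} (k : Fin d → ℤ) : hartley d k = casL2 k := by
  simp [hartley]

/-! ### The Sobolev space `H¹` in Hartley coordinates -/

lemma isWeakPartial_iff {d : ℕ} (i : Fin d) (u g : L2 d) :
    IsWeakPartial i u g ↔ ∀ φ : Torus d → ℝ, ∀ hφ : SmoothOnTorus φ,
      inner ℝ u (contL2 _ (hφ.partialDeriv_smooth i).continuous) =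
        - inner ℝ g (contL2 φ hφ.continuous) := by
  simp only [inner_contL2, IsWeakPartial]

lemma isClosed_H1 (d : ℕ) :
    IsClosed (H1 d : Set (WithLp 2 (L2 d × PiLp 2 (fun _ : Fin d => L2 d)))) := by
  have : (H1 d : Set (WithLp 2 (L2 d × PiLp 2 (fun _ : Fin d => L2 d)))) =
      ⋂ (i : Fin d) (φ : Torus d → ℝ) (hφ : SmoothOnTorus φ),
        {p | inner ℝ p.fst (contL2 _ (hφ.partialDeriv_smooth i).continuous) =
          - inner ℝ (p.snd i) (contL2 φ hφ.continuous)} := by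
    ext p
    simp only [mem_iInter, mem_ofPred_eq, ← isWeakPartial_iff]
    rfl
  rw [this]
  refine isClosed_iInter fun i => isClosed_iInter fun φ => isClosed_iInter fun hφ =>
    isClosed_eq ?_ ?_
  · exact (WithLp.fstL 2 ℝ (L2 d) (PiLp 2 (fun _ : Fin d => L2 d))).continuous.inner
      continuous_const
  · exact (((PiLp.proj 2 (𝕜 := ℝ) (fun _ : Fin d => L2 d) i).continuous.comp
      (WithLp.sndL 2 ℝ (L2 d) (PiLp 2 (fun _ : Fin d => L2 d))).continuous).inner
      continuous_const).neg

instance (d : ℕ) : CompleteSpace (H1 d) := (isClosed_H1 d).completeSpace_coe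

lemma isWeakPartial_casL2 {d : ℕ} (k : Fin d → ℤ) (i : Fin d) :
    IsWeakPartial i (casL2 k) ((2 * Real.pi * k i) • casL2 (-k)) := by
  rw [isWeakPartial_iff]
  intro φ hφ
  rw [inner_smul_left, real_inner_comm, casL2, inner_contL2, real_inner_comm, casL2, inner_contL2]
  have e1 : ∫ x, (contL2 (partialDeriv i φ) (hφ.partialDeriv_smooth i).continuous : L2 d) x *
      cas k x = ∫ x, cas k x * partialDeriv i φ x :=
    integral_congr_ae (by
      filter_upwards [contL2_coe (partialDeriv i φ) (hφ.partialDeriv_smooth i).continuous]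
        with x hx
      rw [hx, mul_comm])
  have e2 : ∫ x, (contL2 φ hφ.continuous : L2 d) x * cas (-k) x = ∫ x, φ x * cas (-k) x :=
    integral_congr_ae (by filter_upwards [contL2_coe φ hφ.continuous] with x hx; rw [hx])
  rw [e1, e2, integral_mul_partialDeriv (cas_smooth k) hφ, partialDeriv_cas]
  simp only [mul_assoc, integral_const_mul, RCLike.conj_to_real]
  simp only [mul_comm (φ _)]

/-- The Hartley function `cas k` as an element of `H¹`, with its gradient. -/
def casH1 {d : ℕ} (k : Fin d → ℤ) : H1 d :=
  ⟨WithLp.toLp 2 (casL2 k, WithLp.toLp 2 fun i => (2 * Real.pi * k i) • casL2 (-k)),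
    fun i => isWeakPartial_casL2 k i⟩

@[simp] lemma toL2_casH1 {d : ℕ} (k : Fin d → ℤ) : toL2 d (casH1 k) = casL2 k := rfl

lemma toL2_apply {d : ℕ} (z : H1 d) : toL2 d z = z.1.fst := rfl

lemma inner_grad_casL2 {d : ℕ} (z : H1 d) (k : Fin d → ℤ) (i : Fin d) :
    inner ℝ (z.1.snd i) (casL2 (-k)) = 2 * Real.pi * k i * inner ℝ (toL2 d z) (casL2 k) := by
  have h := z.2 i (cas (-k)) (cas_smooth _)
  rw [partialDeriv_cas] at h
  simp only [neg_neg, mul_left_comm, integral_const_mul] at h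
  rw [inner_casL2, inner_casL2, toL2_apply]
  simp only [Pi.neg_apply, Int.cast_neg] at h
  linarith

lemma inner_casH1 {d : ℕ} (z : H1 d) (k : Fin d → ℤ) :
    inner ℝ z (casH1 k) = (1 + eigenvalue k) * inner ℝ (toL2 d z) (casL2 k) := by
  have h : inner ℝ z (casH1 k) = inner ℝ z.1.fst (casL2 k) +
      ∑ i, inner ℝ (z.1.snd i) ((2 * Real.pi * k i) • casL2 (-k)) := by
    rw [Submodule.coe_inner, WithLp.prod_inner_apply, PiLp.inner_apply]
    rfl
  rw [h]
  simp only [inner_smul_right, inner_grad_casL2, toL2_apply, eigenvalue, add_mul, one_mul,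
    Finset.sum_mul]
  congr 1
  exact Finset.sum_congr rfl fun i _ => by ring

lemma one_add_eigenvalue_pos {d : ℕ} (k : Fin d → ℤ) : 0 < 1 + eigenvalue k := by
  have := eigenvalue_nonneg k; linarith

lemma toL2_injective (d : ℕ) : Function.Injective (toL2 d) := by
  rw [injective_iff_map_eq_zero]
  intro z hz
  have h1 : z.1.fst = 0 := hz
  have h2 : z.1.snd = 0 := by
    refine PiLp.ext fun i => ?_
    refine eq_zero_of_inner_casL2 _ fun k => ?_
    have := inner_grad_casL2 z (-k) i
    rw [hz, inner_zero_left, mul_zero, neg_neg] at this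
    exact this
  ext1
  exact WithLp.ofLp_injective 2 (Prod.ext h1 h2)

lemma H1_inner_smul_right {d : ℕ} (c : ℝ) (y z : H1 d) :
    inner ℝ y (c • z) = c * inner ℝ y z := real_inner_smul_right y z c

lemma H1_inner_smul_left {d : ℕ} (c : ℝ) (y z : H1 d) :
    inner ℝ (c • y) z = c * inner ℝ y z := real_inner_smul_left y z c

/-- The Hilbert basis of `H¹(T^d)` made of the normalized Hartley functions. -/
def hartleyH1 (d : ℕ) : HilbertBasis (Fin d → ℤ) ℝ (H1 d) :=
  HilbertBasis.mkOfOrthogonalEqBot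
    (v := fun k : Fin d → ℤ => (Real.sqrt (1 + eigenvalue k))⁻¹ • casH1 k)
    (by
      rw [orthonormal_iff_ite]
      intro k l
      simp only [H1_inner_smul_left, H1_inner_smul_right]
      rw [inner_casH1, toL2_casH1, orthonormal_iff_ite.1 (orthonormal_casL2 d)]
      split_ifs with h
      · subst h
        have h0 := one_add_eigenvalue_pos k
        rw [← mul_assoc, ← mul_inv, Real.mul_self_sqrt h0.le, mul_one, inv_mul_cancel₀ h0.ne']
      · simp)
    (by
      rw [Submodule.eq_bot_iff]
      intro z hz
      apply toL2_injective
      rw [map_zero]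
      refine eq_zero_of_inner_casL2 _ fun k => ?_
      have h0 := one_add_eigenvalue_pos k
      have := (Submodule.mem_orthogonal _ _).1 hz _ (Submodule.subset_span ⟨k, rfl⟩)
      rw [real_inner_comm] at this
      simp only [H1_inner_smul_right] at this
      rw [inner_casH1] at this
      have h1 : (Real.sqrt (1 + eigenvalue k))⁻¹ ≠ 0 := inv_ne_zero (Real.sqrt_pos.2 h0).ne'
      simpa [h1, h0.ne'] using this)

lemma hartleyH1_apply {d : ℕ} (k : Fin d → ℤ) :
    hartleyH1 d k = (Real.sqrt (1 + eigenvalue k))⁻¹ • casH1 k := by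
  simp [hartleyH1]

/-- A continuous linear functional on `H¹` is determined by its values at the Hartley functions. -/
lemma Hneg1_ext {d : ℕ} {p q : Hneg1 d} (h : ∀ k, p (casH1 k) = q (casH1 k)) : p = q := by
  refine ContinuousLinearMap.ext_on
    (Submodule.dense_iff_topologicalClosure_eq_top.2 (hartleyH1 d).dense_span) ?_
  rintro _ ⟨k, rfl⟩
  simp [hartleyH1_apply, h]

/-- The Riesz map of a real inner product space, as a continuous linear map (`innerSL ℝ` is typed
as a conjugate-linear one). -/
def rieszMap (E : Type*) [NormedAddCommGroup E] [InnerProductSpace ℝ E] :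
    E →L[ℝ] StrongDual ℝ E :=
  LinearMap.mkContinuous
    { toFun := fun x => innerSL ℝ x
      map_add' := fun x y => map_add _ x y
      map_smul' := fun c x => by ext z; simp } 1
    (fun x => by simp)

/-- The embedding `L²(T^d) → H⁻¹(T^d)`, `f ↦ (z ↦ ∫ f z)`. -/
def ofL2 (d : ℕ) : L2 d →L[ℝ] Hneg1 d :=
  LinearMap.mkContinuous
    { toFun := fun f => (innerSL ℝ f).comp (toL2 d)
      map_add' := fun x y => by ext z; simp
      map_smul' := fun c x => by ext z; simp } ‖toL2 d‖
    (fun x => by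
      refine (ContinuousLinearMap.opNorm_comp_le _ _).trans ?_
      rw [innerSL_apply_norm, mul_comm])

lemma ofL2_apply {d : ℕ} (f : L2 d) (z : H1 d) : ofL2 d f z = inner ℝ f (toL2 d z) := rfl

lemma toHneg1_eq {d : ℕ} (u : H1 d) : toHneg1 u = ofL2 d (toL2 d u) := rfl

/-- `-Δ : H¹(T^d) → H⁻¹(T^d)`.  The pairing `∑ i, ∫ ∂_i u ∂_i z` is the `H¹` inner product minus
the `L²` inner product. -/
def negLaplacian (d : ℕ) : H1 d →L[ℝ] Hneg1 d := rieszMap (H1 d) - (ofL2 d).comp (toL2 d)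

lemma negLaplacian_casH1 {d : ℕ} (u : H1 d) (k : Fin d → ℤ) :
    negLaplacian d u (casH1 k) = eigenvalue k * inner ℝ (toL2 d u) (casL2 k) := by
  have : negLaplacian d u (casH1 k) =
      inner ℝ u (casH1 k) - inner ℝ (toL2 d u) (toL2 d (casH1 k)) := rfl
  rw [this, inner_casH1, toL2_casH1]
  ring

/-! ### Translations and the heat semigroup -/

/-- Translation of `L²` functions: `shift z f = f (z + ·)`. -/
def shift {d : ℕ} (z : Torus d) : L2 d →ₗᵢ[ℝ] L2 d :=
  Lp.compMeasurePreservingₗᵢ ℝ (fun x => z + x) (measurePreserving_add_left volume z)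

lemma shift_coe {d : ℕ} (z : Torus d) (f : L2 d) : shift z f =ᵐ[volume] fun x => f (z + x) :=
  Lp.coeFn_compMeasurePreserving f (measurePreserving_add_left volume z)

lemma ae_shift {d : ℕ} {p : Torus d → Prop} (h : ∀ᵐ x, p x) (z : Torus d) : ∀ᵐ x, p (z + x) :=
  (measurePreserving_add_left volume z).quasiMeasurePreserving.ae h

lemma continuous_shift {d : ℕ} (f : L2 d) : Continuous fun z : Torus d => shift z f := by
  have h := (continuous_const (y := f)).compMeasurePreservingLp (Z := Torus d)
    (g := fun z : Torus d => ⟨fun x => z + x, continuous_const_add z⟩)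
    (ContinuousMap.curry ⟨fun p : Torus d × Torus d => p.1 + p.2, continuous_add⟩).continuous
    (fun z => measurePreserving_add_left volume z) (by simp)
  exact h

lemma nonneg_iff {d : ℕ} (f : L2 d) : 0 ≤ f ↔ ∀ᵐ x, 0 ≤ f x := by
  rw [← Lp.coeFn_le]
  refine ⟨fun h => ?_, fun h => ?_⟩
  · filter_upwards [h, Lp.coeFn_zero ℝ 2 (volume : Measure (Torus d))] with x h1 h2
    rwa [h2] at h1
  · filter_upwards [h, Lp.coeFn_zero ℝ 2 (volume : Measure (Torus d))] with x h1 h2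
    rwa [h2]

lemma smul_nonneg_L2 {d : ℕ} {c : ℝ} (hc : 0 ≤ c) {f : L2 d} (hf : 0 ≤ f) : 0 ≤ c • f := by
  rw [nonneg_iff] at hf ⊢
  filter_upwards [Lp.coeFn_smul c f, hf] with x h1 h2
  rw [h1]
  exact mul_nonneg hc h2

instance (d : ℕ) : IsOrderedModule ℝ (L2 d) where
  smul_le_smul_of_nonneg_left c hc f g hfg := by
    have := smul_nonneg_L2 hc (sub_nonneg.2 hfg)
    rwa [smul_sub, sub_nonneg] at this
  smul_le_smul_of_nonneg_right f hf b c hbc := by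
    have := smul_nonneg_L2 (sub_nonneg.2 hbc) hf
    rwa [sub_smul, sub_nonneg] at this

lemma shift_nonneg {d : ℕ} (z : Torus d) {f : L2 d} (hf : 0 ≤ f) : 0 ≤ shift z f := by
  rw [nonneg_iff] at hf ⊢
  filter_upwards [shift_coe z f, ae_shift hf z] with x h1 h2
  rwa [h1]

lemma inner_shift_casL2 {d : ℕ} (y : Fin d → ℝ) (f : L2 d) (k : Fin d → ℤ) :
    inner ℝ (shift (proj y) f) (casL2 k) =
      Real.cos (phase k y) * inner ℝ f (casL2 k) -
        Real.sin (phase k y) * inner ℝ f (casL2 (-k)) := by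
  have e1 : ∫ x, shift (proj y) f x * cas k x = ∫ x, f (proj y + x) * cas k x :=
    integral_congr_ae (by filter_upwards [shift_coe (proj y) f] with x hx; rw [hx])
  have e2 : ∫ x, f (proj y + x) * cas k x = ∫ x, f x * cas k (x + proj (-y)) := by
    rw [← integral_add_left_eq_self (fun x => f x * cas k (x + proj (-y))) (proj y)]
    refine integral_congr_ae (Eventually.of_forall fun x => ?_)
    have : (proj y + x + proj (-y) : Torus d) = x := by
      rw [add_right_comm, ← proj_add, add_neg_cancel]
      have : (proj 0 : Torus d) = 0 := by funext i; simp [proj]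
      rw [this, zero_add]
    simp only [this]
  have hp : phase k (-y) = - phase k y := by simpa using phase_smul k (-1) y
  simp only [inner_casL2]
  rw [e1, e2]
  simp only [cas_add_proj, mul_add, hp, Real.cos_neg, Real.sin_neg, neg_mul, mul_neg,
    mul_left_comm _ (Real.cos _), mul_left_comm _ (Real.sin _)]
  rw [integral_add, integral_neg, integral_const_mul, integral_const_mul, sub_eq_add_neg]
  · exact (integrable_mul_of_continuous f (cas_smooth k).continuous).const_mul _
  · exact ((integrable_mul_of_continuous f (cas_smooth (-k)).continuous).const_mul _).neg

/-- The standard Gaussian measure on `ℝ^d`. -/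
def gaussian (d : ℕ) : Measure (Fin d → ℝ) :=
  Measure.pi fun _ => ProbabilityTheory.gaussianReal 0 1

instance (d : ℕ) : IsProbabilityMeasure (gaussian d) :=
  inferInstanceAs (IsProbabilityMeasure (Measure.pi _))

/-- The characteristic function of the Gaussian, which gives the heat multipliers `e^{-tλ_k}`. -/
lemma integral_gaussian_exp_phase {d : ℕ} (k : Fin d → ℤ) (r : ℝ) :
    ∫ y, Complex.exp ((r * phase k y : ℝ) * Complex.I) ∂gaussian d =
      ((Real.exp (-(r ^ 2 / 2 * eigenvalue k)) : ℝ) : ℂ) := by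
  have h1 : ∀ y : Fin d → ℝ, Complex.exp ((r * phase k y : ℝ) * Complex.I) =
      ∏ i, Complex.exp (((r * (2 * Real.pi * k i) : ℝ) : ℂ) * (y i : ℂ) * Complex.I) := by
    intro y
    rw [← Complex.exp_sum]
    congr 1
    simp only [phase, Finset.mul_sum, Complex.ofReal_sum, Finset.sum_mul]
    refine Finset.sum_congr rfl fun i _ => ?_
    push_cast; ring
  simp only [h1]
  rw [gaussian, integral_fintype_prod_eq_prod
    (f := fun i (s : ℝ) => Complex.exp (((r * (2 * Real.pi * k i) : ℝ) : ℂ) * s * Complex.I))]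
  simp only [← charFun_apply_real, ProbabilityTheory.charFun_gaussianReal]
  rw [← Complex.exp_sum, Complex.ofReal_exp]
  congr 1
  simp only [eigenvalue]
  push_cast
  rw [Finset.mul_sum, ← Finset.sum_neg_distrib]
  refine Finset.sum_congr rfl fun i _ => ?_
  ring

lemma integrable_gaussian_exp_phase {d : ℕ} (k : Fin d → ℤ) (r : ℝ) :
    Integrable (fun y => Complex.exp ((r * phase k y : ℝ) * Complex.I)) (gaussian d) := by
  refine Integrable.of_bound (C := 1) ?_ (Eventually.of_forall fun y => ?_)
  · have := (phase_contDiff k).continuous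
    exact Continuous.aestronglyMeasurable (by fun_prop)
  · rw [Complex.norm_exp_ofReal_mul_I]

lemma integral_gaussian_cos {d : ℕ} (k : Fin d → ℤ) (r : ℝ) :
    ∫ y, Real.cos (r * phase k y) ∂gaussian d = Real.exp (-(r ^ 2 / 2 * eigenvalue k)) := by
  have h := Complex.reCLM.integral_comp_comm (integrable_gaussian_exp_phase k r)
  rw [integral_gaussian_exp_phase] at h
  simpa only [Complex.reCLM_apply, Complex.exp_ofReal_mul_I_re, Complex.ofReal_re] using h

lemma integral_gaussian_sin {d : ℕ} (k : Fin d → ℤ) (r : ℝ) :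
    ∫ y, Real.sin (r * phase k y) ∂gaussian d = 0 := by
  have h := Complex.imCLM.integral_comp_comm (integrable_gaussian_exp_phase k r)
  rw [integral_gaussian_exp_phase] at h
  simpa only [Complex.imCLM_apply, Complex.exp_ofReal_mul_I_im, Complex.ofReal_im] using h

/-- The heat semigroup `exp (t Δ)` on `L²(T^d)`, realized as the average of the translations over
a centred Gaussian of variance `2t`.  For `t ≤ 0` it is the identity (`Real.sqrt` vanishes). -/
def heat {d : ℕ} (t : ℝ) (f : L2 d) : L2 d :=
  ∫ y, shift (proj (Real.sqrt (2 * t) • y)) f ∂gaussian d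

lemma continuous_heat_integrand {d : ℕ} (t : ℝ) (f : L2 d) :
    Continuous fun y : Fin d → ℝ => shift (proj (Real.sqrt (2 * t) • y)) f :=
  (continuous_shift f).comp ((continuous_proj d).comp (continuous_const_smul _))

lemma integrable_heat {d : ℕ} (t : ℝ) (f : L2 d) :
    Integrable (fun y => shift (proj (Real.sqrt (2 * t) • y)) f) (gaussian d) :=
  Integrable.of_bound (C := ‖f‖) (continuous_heat_integrand t f).aestronglyMeasurable
    (Eventually.of_forall fun y => by rw [LinearIsometry.norm_map])

lemma inner_heat_casL2 {d : ℕ} {t : ℝ} (ht : 0 ≤ t) (f : L2 d) (k : Fin d → ℤ) :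
    inner ℝ (heat t f) (casL2 k) = Real.exp (-(t * eigenvalue k)) * inner ℝ f (casL2 k) := by
  rw [heat, real_inner_comm, ← integral_inner (integrable_heat t f)]
  simp only [real_inner_comm _ (casL2 k), inner_shift_casL2, phase_smul]
  have hc : Continuous (phase k : (Fin d → ℝ) → ℝ) := (phase_contDiff k).continuous
  rw [integral_sub, integral_mul_const, integral_mul_const, integral_gaussian_cos,
    integral_gaussian_sin, Real.sq_sqrt (by positivity)]
  · rw [zero_mul, sub_zero, mul_div_cancel_left₀ _ two_ne_zero]
  · exact (Integrable.of_bound (C := 1) (Continuous.aestronglyMeasurable (by fun_prop))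
      (Eventually.of_forall fun y => Real.abs_cos_le_one _)).mul_const _
  · exact (Integrable.of_bound (C := 1) (Continuous.aestronglyMeasurable (by fun_prop))
      (Eventually.of_forall fun y => Real.abs_sin_le_one _)).mul_const _

lemma norm_heat_le {d : ℕ} (t : ℝ) (f : L2 d) : ‖heat t f‖ ≤ ‖f‖ := by
  refine (norm_integral_le_of_norm_le_const (C := ‖f‖)
    (Eventually.of_forall fun y => by rw [LinearIsometry.norm_map])).trans ?_
  simp

lemma heat_sub {d : ℕ} (t : ℝ) (f g : L2 d) : heat t (f - g) = heat t f - heat t g := by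
  simp only [heat, map_sub]
  exact integral_sub (integrable_heat t f) (integrable_heat t g)

lemma heat_nonneg {d : ℕ} (t : ℝ) {f : L2 d} (hf : 0 ≤ f) : 0 ≤ heat t f :=
  integral_nonneg fun _ => shift_nonneg _ hf

lemma continuous_heat (d : ℕ) : Continuous fun p : ℝ × L2 d => heat p.1 p.2 := by
  refine continuous_prod_of_continuous_lipschitzWith' _ 1 (fun t => ?_) (fun f => ?_)
  · refine LipschitzWith.of_dist_le_mul fun f g => ?_
    rw [dist_eq_norm, dist_eq_norm, ← heat_sub, NNReal.coe_one, one_mul]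
    exact norm_heat_le _ _
  · refine continuous_of_dominated (bound := fun _ => ‖f‖)
      (fun t => (continuous_heat_integrand t f).aestronglyMeasurable)
      (fun t => Eventually.of_forall fun y => by rw [LinearIsometry.norm_map])
      (integrable_const _) (Eventually.of_forall fun y => ?_)
    refine (continuous_shift f).comp ((continuous_proj d).comp ?_)
    fun_prop

/-! ### Primitives on an interval and their weak derivatives -/

/-- `y` is on `[0,T]` a primitive of `g`: this is the integrated form of `y' = g`. -/
def IsPrimitive (T : ℝ) (y g : ℝ → ℝ) : Prop :=
  ∀ t ∈ Icc 0 T, y t = y 0 + ∫ s in 0..t, g s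

lemma IsPrimitive.continuousOn {T : ℝ} {y g : ℝ → ℝ} (h : IsPrimitive T y g)
    (hg : IntervalIntegrable g volume 0 T) (hT : 0 ≤ T) : ContinuousOn y (Icc 0 T) := by
  have h1 : ContinuousOn (fun t => y 0 + ∫ s in 0..t, g s) (Icc 0 T) := by
    have := intervalIntegral.continuousOn_primitive_interval' hg left_mem_uIcc
    rw [uIcc_of_le hT] at this
    exact continuousOn_const.add this
  exact h1.congr fun t ht => h t ht

lemma IsPrimitive.congr {T : ℝ} {y g z h : ℝ → ℝ} (hy : IsPrimitive T y g) (hT : 0 ≤ T)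
    (hz : ∀ t ∈ Icc 0 T, y t = z t) (hh : ∀ᵐ t ∂volume, t ∈ Ioc 0 T → g t = h t) :
    IsPrimitive T z h := by
  intro t ht
  rw [← hz t ht, ← hz 0 (left_mem_Icc.2 hT), hy t ht]
  congr 1
  refine intervalIntegral.integral_congr_ae ?_
  filter_upwards [hh] with s hs hs'
  rw [uIoc_of_le ht.1] at hs'
  exact hs ⟨hs'.1, hs'.2.trans ht.2⟩

/-- The product rule. -/
lemma IsPrimitive.mul {T : ℝ} {y g z h : ℝ → ℝ} (hy : IsPrimitive T y g) (hz : IsPrimitive T z h)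
    (hg : IntervalIntegrable g volume 0 T) (hh : IntervalIntegrable h volume 0 T) :
    IsPrimitive T (fun t => y t * z t) (fun t => g t * z t + y t * h t) := by
  intro t ht
  have hsub : uIcc 0 t ⊆ uIcc 0 T := by
    rw [uIcc_of_le ht.1, uIcc_of_le (ht.1.trans ht.2)]
    exact Icc_subset_Icc_right ht.2
  have hg' := hg.mono_set hsub
  have hh' := hh.mono_set hsub
  have ac : ∀ {f : ℝ → ℝ} (a : ℝ), IntervalIntegrable f volume 0 t →
      AbsolutelyContinuousOnInterval (fun x => a + ∫ s in 0..x, f s) 0 t := by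
    intro f a hf
    have h1 := hf.absolutelyContinuousOnInterval_intervalIntegral (c := 0) left_mem_uIcc
    have h2 : AbsolutelyContinuousOnInterval (fun _ : ℝ => a) 0 t :=
      (contDiffOn_const).absolutelyContinuousOnInterval
    exact h2.add h1
  have key := (ac (y 0) hg').integral_deriv_mul_eq_sub (ac (z 0) hh')
  rw [← hy t ht, ← hz t ht] at key
  simp only [intervalIntegral.integral_same, add_zero] at key
  rw [← sub_eq_iff_eq_add', ← key]
  refine intervalIntegral.integral_congr_ae ?_
  filter_upwards [hg'.ae_hasDerivAt_integral, hh'.ae_hasDerivAt_integral] with x h1 h2 hx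
  have hx' : x ∈ uIcc 0 t := uIoc_subset_uIcc hx
  have hxT : x ∈ Icc 0 T := by
    have := hsub hx'
    rwa [uIcc_of_le (ht.1.trans ht.2)] at this
  rw [((h1 hx' 0 left_mem_uIcc).const_add _).deriv, ((h2 hx' 0 left_mem_uIcc).const_add _).deriv,
    ← hy x hxT, ← hz x hxT]

lemma isPrimitive_of_contDiff {T : ℝ} {y : ℝ → ℝ} (hy : ContDiff ℝ 1 y) :
    IsPrimitive T y (deriv y) := by
  intro t _
  rw [intervalIntegral.integral_deriv_eq_sub (fun x _ => hy.differentiable (by simp) x)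
    ((hy.continuous_deriv le_rfl).intervalIntegrable _ _)]
  ring

lemma IsPrimitive.exp_mul {T : ℝ} {y g : ℝ → ℝ} (hy : IsPrimitive T y g)
    (hg : IntervalIntegrable g volume 0 T) (r : ℝ) :
    IsPrimitive T (fun t => Real.exp (r * t) * y t)
      (fun t => Real.exp (r * t) * (g t + r * y t)) := by
  have hd : ∀ t, HasDerivAt (fun t => Real.exp (r * t)) (Real.exp (r * t) * r) t := by
    intro t
    simpa using ((hasDerivAt_id t).const_mul r).exp
  have hc : ContDiff ℝ 1 fun t => Real.exp (r * t) := by fun_prop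
  have h := (isPrimitive_of_contDiff (T := T) hc).mul hy
    ((hc.continuous_deriv le_rfl).intervalIntegrable _ _) hg
  intro t ht
  rw [h t ht]
  congr 1
  refine intervalIntegral.integral_congr fun s _ => ?_
  simp only [(hd s).deriv]
  ring

lemma integral_Ioo_eq_interval {E : Type*} [NormedAddCommGroup E] [NormedSpace ℝ E] {T : ℝ}
    (hT : 0 ≤ T) (f : ℝ → E) : ∫ t, f t ∂timeMeasure T = ∫ t in 0..T, f t := by
  rw [intervalIntegral.integral_of_le hT, integral_Ioc_eq_integral_Ioo]

lemma intervalIntegrable_iff_timeMeasure {E : Type*} [NormedAddCommGroup E] {T : ℝ}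
    (hT : 0 ≤ T) (f : ℝ → E) :
    IntervalIntegrable f volume 0 T ↔ Integrable f (timeMeasure T) := by
  rw [intervalIntegrable_iff_integrableOn_Ioo_of_le hT]
  rfl

lemma integrable_timeMeasure_of_continuousOn {E : Type*} [NormedAddCommGroup E] {T : ℝ}
    {f : ℝ → E} (hf : ContinuousOn f (Icc 0 T)) : Integrable f (timeMeasure T) :=
  (hf.integrableOn_Icc).mono_set Ioo_subset_Icc_self

lemma aestronglyMeasurable_timeMeasure_of_continuousOn {E : Type*} [NormedAddCommGroup E]
    {T : ℝ} {f : ℝ → E} (hf : ContinuousOn f (Icc 0 T)) :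
    AEStronglyMeasurable f (timeMeasure T) :=
  (integrable_timeMeasure_of_continuousOn hf).aestronglyMeasurable

/-- A primitive has the expected weak derivative. -/
lemma IsPrimitive.integral_deriv_mul {T : ℝ} (hT : 0 ≤ T) {y g θ : ℝ → ℝ}
    (hy : IsPrimitive T y g) (hg : Integrable g (timeMeasure T)) (hθ : ContDiff ℝ 1 θ)
    (h0 : θ 0 = 0) (h1 : θ T = 0) :
    ∫ t, deriv θ t * y t ∂timeMeasure T = - ∫ t, θ t * g t ∂timeMeasure T := by
  have hg' := (intervalIntegrable_iff_timeMeasure hT g).2 hg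
  have hθ' := (hθ.continuous_deriv le_rfl).intervalIntegrable (μ := volume) 0 T
  have hyc := hy.continuousOn hg' hT
  rw [← uIcc_of_le hT] at hyc
  have h := (isPrimitive_of_contDiff (T := T) hθ).mul hy hθ' hg' T (right_mem_Icc.2 hT)
  simp only at h
  rw [h0, h1, zero_mul, zero_mul, zero_add, intervalIntegral.integral_add
    (hθ'.mul_continuousOn hyc) (hg'.continuousOn_mul hθ.continuous.continuousOn)] at h
  rw [integral_Ioo_eq_interval hT, integral_Ioo_eq_interval hT]
  linarith

/-- The energy estimate for `y' = -λ y + f`. -/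
lemma IsPrimitive.energy {T l : ℝ} (hT : 0 ≤ T) {y f : ℝ → ℝ}
    (hy : IsPrimitive T y (fun t => -l * y t + f t)) (hyc : ContinuousOn y (Icc 0 T))
    (hf : Integrable f (timeMeasure T)) (hf2 : Integrable (fun t => f t ^ 2) (timeMeasure T)) :
    l * ∫ t, y t ^ 2 ∂timeMeasure T ≤
      (y 0 ^ 2 + ∫ t, y t ^ 2 ∂timeMeasure T + ∫ t, f t ^ 2 ∂timeMeasure T) / 2 := by
  have hyi := integrable_timeMeasure_of_continuousOn hyc
  have hy2 : Integrable (fun t => y t ^ 2) (timeMeasure T) :=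
    integrable_timeMeasure_of_continuousOn (hyc.pow 2)
  have hg : Integrable (fun t => -l * y t + f t) (timeMeasure T) := (hyi.const_mul _).add hf
  have hg' := (intervalIntegrable_iff_timeMeasure hT _).2 hg
  have h := hy.mul hy hg' hg' T (right_mem_Icc.2 hT)
  rw [← integral_Ioo_eq_interval hT] at h
  have hyf : Integrable (fun t => y t * f t) (timeMeasure T) := by
    refine (hy2.add hf2).mono (hyi.aestronglyMeasurable.mul hf.aestronglyMeasurable) ?_
    refine Eventually.of_forall fun t => ?_
    simp only [Pi.add_apply, norm_mul, Real.norm_eq_abs]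
    rw [abs_of_nonneg (add_nonneg (sq_nonneg (y t)) (sq_nonneg (f t))), ← sq_abs (y t),
      ← sq_abs (f t)]
    nlinarith [sq_nonneg (|y t| - |f t|), abs_nonneg (y t), abs_nonneg (f t)]
  have e : ∫ t, (-l * y t + f t) * y t + y t * (-l * y t + f t) ∂timeMeasure T =
      -2 * l * (∫ t, y t ^ 2 ∂timeMeasure T) + 2 * ∫ t, y t * f t ∂timeMeasure T := by
    rw [← integral_const_mul, ← integral_const_mul, ← integral_add (hy2.const_mul _)
      (hyf.const_mul _)]
    refine integral_congr_ae (Eventually.of_forall fun t => ?_)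
    ring
  have h3 : 2 * ∫ t, y t * f t ∂timeMeasure T ≤
      (∫ t, y t ^ 2 ∂timeMeasure T) + ∫ t, f t ^ 2 ∂timeMeasure T := by
    rw [← integral_const_mul, ← integral_add hy2 hf2]
    refine integral_mono (hyf.const_mul _) (hy2.add hf2) fun t => ?_
    nlinarith [sq_nonneg (y t - f t)]
  rw [e] at h
  nlinarith [mul_self_nonneg (y T)]

/-- Variation of constants for `y' = -l y + f`. -/
lemma isPrimitive_iff_mild {T l : ℝ} (hT : 0 ≤ T) {y f : ℝ → ℝ}
    (hyc : ContinuousOn y (Icc 0 T)) (hf : Integrable f (timeMeasure T)) :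
    IsPrimitive T y (fun t => -l * y t + f t) ↔
      ∀ t ∈ Icc 0 T, y t = Real.exp (-(l * t)) * y 0 +
        ∫ s in 0..t, Real.exp (-(l * (t - s))) * f s := by
  have hyi := integrable_timeMeasure_of_continuousOn hyc
  have hf' := (intervalIntegrable_iff_timeMeasure hT _).2 hf
  have hg' : IntervalIntegrable (fun t => -l * y t + f t) volume 0 T :=
    (intervalIntegrable_iff_timeMeasure hT _).2 ((hyi.const_mul _).add hf)
  have e : ∀ t, ∫ s in 0..t, Real.exp (-(l * (t - s))) * f s =
      Real.exp (-l * t) * ∫ s in 0..t, Real.exp (l * s) * f s := by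
    intro t
    rw [← intervalIntegral.integral_const_mul]
    refine intervalIntegral.integral_congr fun s _ => ?_
    rw [← mul_assoc, ← Real.exp_add]
    congr 2; ring
  constructor
  · intro h t ht
    have h1 := h.exp_mul hg' l t ht
    have e1 : ∀ s, Real.exp (l * s) * (-l * y s + f s + l * y s) = Real.exp (l * s) * f s :=
      fun s => by ring
    simp only [e1, mul_zero, Real.exp_zero, one_mul] at h1
    rw [e, ← neg_mul, ← mul_add, ← h1, ← mul_assoc, ← Real.exp_add]
    simp
  · intro h
    have hF : IntervalIntegrable (fun s => Real.exp (l * s) * f s) volume 0 T :=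
      hf'.continuousOn_mul (by fun_prop)
    have hP : IsPrimitive T (fun t => y 0 + ∫ s in 0..t, Real.exp (l * s) * f s)
        (fun s => Real.exp (l * s) * f s) := fun t _ => by simp
    refine (hP.exp_mul hF (-l)).congr hT (fun t ht => ?_) ?_
    · rw [h t ht, e, ← neg_mul, ← mul_add]
    · refine Eventually.of_forall fun t ht => ?_
      have e2 : Real.exp (-(l * t)) * Real.exp (l * t) = 1 := by
        rw [← Real.exp_add]; simp
      rw [h t ⟨ht.1.le, ht.2⟩, e, neg_mul]
      linear_combination f t * e2

/-- Every test function is the sum of a multiple of a fixed test function `ρ` of integral `1` and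
of the derivative of a test function. -/
lemma exists_timeTest_deriv {T : ℝ} {η ρ : ℝ → ℝ} (hη : IsTimeTest T η) (hρ : IsTimeTest T ρ)
    (hρ1 : ∫ t, ρ t = 1) :
    ∃ θ, IsTimeTest T θ ∧ ∀ t, deriv θ t = η t - (∫ s, η s) * ρ t := by
  have hηi : Integrable η := hη.1.continuous.integrable_of_hasCompactSupport hη.2.1
  have hρi : Integrable ρ := hρ.1.continuous.integrable_of_hasCompactSupport hρ.2.1
  set g : ℝ → ℝ := fun t => η t - (∫ s, η s) * ρ t with hg
  have hgs : ContDiff ℝ ∞ g := hη.1.sub (contDiff_const.mul hρ.1)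
  have hgi : Integrable g := hηi.sub (hρi.const_mul _)
  have hg0 : ∫ t, g t = 0 := by
    rw [hg, integral_sub hηi (hρi.const_mul _), integral_const_mul, hρ1]; ring
  have hd : ∀ t, HasDerivAt (fun t => ∫ s in 0..t, g s) (g t) t := fun t =>
    intervalIntegral.integral_hasDerivAt_right (hgs.continuous.intervalIntegrable _ _)
      (hgs.continuous.stronglyMeasurableAtFilter _ _) hgs.continuous.continuousAt
  have hderiv : deriv (fun t => ∫ s in 0..t, g s) = g := funext fun t => (hd t).deriv
  have hK : IsCompact (tsupport η ∪ tsupport ρ) := hη.2.1.isCompact.union hρ.2.1.isCompact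
  have hKs : tsupport η ∪ tsupport ρ ⊆ Ioo 0 T := union_subset hη.2.2 hρ.2.2
  have hgK : ∀ t, t ∉ tsupport η ∪ tsupport ρ → g t = 0 := by
    intro t ht
    rw [mem_union, not_or] at ht
    simp [hg, image_eq_zero_of_notMem_tsupport ht.1, image_eq_zero_of_notMem_tsupport ht.2]
  obtain ⟨a, b, ha, hb, hab⟩ : ∃ a b, 0 < a ∧ b < T ∧ tsupport η ∪ tsupport ρ ⊆ Icc a b := by
    have hne : (tsupport η ∪ tsupport ρ).Nonempty := by
      by_contra hne
      have hemp := not_nonempty_iff_eq_empty.1 hne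
      have : ρ = 0 := by
        have h2 : tsupport ρ = ∅ := (union_empty_iff.1 hemp).2
        exact tsupport_eq_empty_iff.1 h2
      simp [this] at hρ1
    obtain ⟨a, ha, ha'⟩ := hK.exists_isLeast hne
    obtain ⟨b, hb, hb'⟩ := hK.exists_isGreatest hne
    exact ⟨a, b, (hKs ha).1, (hKs hb).2, fun t ht => ⟨ha' ht, hb' ht⟩⟩
  have hz : ∀ t, t ∉ Icc a b → ∫ s in 0..t, g s = 0 := by
    intro t ht
    rw [mem_Icc, not_and_or, not_le, not_le] at ht
    rcases ht with ht | ht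
    · refine intervalIntegral.integral_zero_ae (Eventually.of_forall fun s hs => hgK s fun hs' => ?_)
      have := (hab hs').1
      rw [mem_uIoc] at hs
      rcases hs with hs | hs <;> linarith [hs.1, hs.2]
    · rcases le_total 0 t with h0 | h0
      · rw [intervalIntegral.integral_of_le h0]
        refine Eq.trans (setIntegral_eq_integral_of_forall_compl_eq_zero
          fun s hs => hgK s fun hs' => hs ?_) hg0
        exact ⟨ha.trans_le (hab hs').1, (hab hs').2.trans ht.le⟩
      · have : ∀ s, g s = 0 := fun s => hgK s fun hs' => by
          linarith [(hab hs').1, (hab hs').2]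
        simp [this]
  have hsupp : tsupport (fun t => ∫ s in 0..t, g s) ⊆ Icc a b :=
    closure_minimal (fun t ht => by
      by_contra h
      exact ht (hz t h)) isClosed_Icc
  refine ⟨fun t => ∫ s in 0..t, g s, ⟨?_, ?_, ?_⟩, fun t => by rw [hderiv]⟩
  · rw [contDiff_infty_iff_deriv, hderiv]
    exact ⟨fun t => (hd t).differentiableAt, hgs⟩
  · exact HasCompactSupport.of_support_subset_isCompact isCompact_Icc
      ((subset_tsupport _).trans hsupp)
  · exact hsupp.trans fun t ht => ⟨ha.trans_le ht.1, ht.2.trans_lt hb⟩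

lemma exists_timeTest_integral_one {T : ℝ} (hT : 0 < T) :
    ∃ ρ, IsTimeTest T ρ ∧ ∫ t, ρ t = 1 := by
  let φ : ContDiffBump (T / 2) := ⟨T / 8, T / 4, by linarith, by linarith⟩
  refine ⟨φ.normed volume, ⟨φ.contDiff_normed, φ.hasCompactSupport_normed, ?_⟩, φ.integral_normed⟩
  rw [φ.tsupport_normed_eq, Real.closedBall_eq_Icc]
  intro t ht
  have h1 : φ.rOut = T / 4 := rfl
  rw [h1] at ht
  exact ⟨by linarith [ht.1], by linarith [ht.2]⟩

/-- The lemma of du Bois-Reymond: a continuous function with weak derivative `g` is a primitive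
of `g`. -/
lemma isPrimitive_of_weak {T : ℝ} (hT : 0 < T) {y g : ℝ → ℝ} (hy : ContinuousOn y (Icc 0 T))
    (hg : Integrable g (timeMeasure T))
    (h : ∀ θ, IsTimeTest T θ →
      ∫ t, deriv θ t * y t ∂timeMeasure T = - ∫ t, θ t * g t ∂timeMeasure T) :
    IsPrimitive T y g := by
  have hg' := (intervalIntegrable_iff_timeMeasure hT.le g).2 hg
  have hPc : ContinuousOn (fun t => ∫ s in 0..t, g s) (Icc 0 T) := by
    have := intervalIntegral.continuousOn_primitive_interval' hg' left_mem_uIcc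
    rwa [uIcc_of_le hT.le] at this
  have hP : IsPrimitive T (fun t => ∫ s in 0..t, g s) g := fun t _ => by simp
  set u : ℝ → ℝ := fun t => y t - ∫ s in 0..t, g s with hu
  have huc : ContinuousOn u (Icc 0 T) := hy.sub hPc
  have tt : ∀ {θ : ℝ → ℝ}, IsTimeTest T θ → θ 0 = 0 ∧ θ T = 0 := fun hθ =>
    ⟨image_eq_zero_of_notMem_tsupport fun h => lt_irrefl _ (hθ.2.2 h).1,
      image_eq_zero_of_notMem_tsupport fun h => lt_irrefl _ (hθ.2.2 h).2⟩
  have mulint : ∀ {θ w : ℝ → ℝ}, Continuous θ → ContinuousOn w (Icc 0 T) →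
      Integrable (fun t => θ t * w t) (timeMeasure T) := fun hθ hw =>
    integrable_timeMeasure_of_continuousOn (hθ.continuousOn.mul hw)
  have h0 : ∀ θ, IsTimeTest T θ → ∫ t, deriv θ t * u t ∂timeMeasure T = 0 := by
    intro θ hθ
    have hθ1 : ContDiff ℝ 1 θ := hθ.1.of_le (by simp)
    have hdc := hθ1.continuous_deriv le_rfl
    have h1 := hP.integral_deriv_mul hT.le hg hθ1 (tt hθ).1 (tt hθ).2
    have h2 := h θ hθ
    simp only [hu, mul_sub]
    rw [integral_sub (mulint hdc hy) (mulint hdc hPc), h1, h2, sub_self]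
  obtain ⟨ρ, hρ, hρ1⟩ := exists_timeTest_integral_one hT
  set c : ℝ := ∫ t, ρ t * u t ∂timeMeasure T with hc
  have hae : ∀ᵐ t ∂volume, t ∈ Ioo 0 T → u t - c = 0 := by
    refine isOpen_Ioo.ae_eq_zero_of_integral_contDiff_smul_eq_zero ?_ fun η hη1 hη2 hη3 => ?_
    · exact ((huc.sub continuousOn_const).mono Ioo_subset_Icc_self).locallyIntegrableOn
        measurableSet_Ioo
    · have hη : IsTimeTest T η := ⟨hη1, hη2, hη3⟩
      obtain ⟨θ, hθ, hθd⟩ := exists_timeTest_deriv hη hρ hρ1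
      have h3 := h0 θ hθ
      simp only [hθd, sub_mul, mul_assoc] at h3
      rw [integral_sub (mulint hη1.continuous huc) ((mulint hρ.1.continuous huc).const_mul _),
        integral_const_mul, ← hc] at h3
      have h4 : ∫ t, η t • (u t - c) = ∫ t, η t * (u t - c) ∂timeMeasure T :=
        (setIntegral_eq_integral_of_forall_compl_eq_zero fun t ht => by
          rw [image_eq_zero_of_notMem_tsupport fun h => ht (hη3 h), zero_smul]).symm
      have h5 : ∫ t, η t = ∫ t, η t ∂timeMeasure T :=
        (setIntegral_eq_integral_of_forall_compl_eq_zero fun t ht =>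
          image_eq_zero_of_notMem_tsupport fun h => ht (hη3 h)).symm
      rw [h4]
      simp only [mul_sub]
      rw [integral_sub (mulint hη1.continuous huc) (mulint hη1.continuous continuousOn_const),
        integral_mul_const, ← h5, h3]
  have heq : EqOn u (fun _ => c) (Icc 0 T) := by
    refine Measure.eqOn_Icc_of_ae_eq (μ := volume) hT.ne ?_ huc continuousOn_const
    rw [← restrict_Ioo_eq_restrict_Icc]
    rw [EventuallyEq, ae_restrict_iff' measurableSet_Ioo]
    filter_upwards [hae] with t ht h
    exact sub_eq_zero.1 (ht h)
  intro t ht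
  have h1 := heq ht
  have h2 := heq (left_mem_Icc.2 hT.le)
  simp only [hu, intervalIntegral.integral_same, sub_zero] at h1 h2
  rw [h2, ← h1]; ring

/-! ### The jump operator -/

/-- Measurability of a Hilbert space valued function can be tested on the coordinates in a
countable Hilbert basis. -/
lemma aestronglyMeasurable_of_coord {α ι E : Type*} [MeasurableSpace α] {μ : Measure α}
    [Countable ι] [NormedAddCommGroup E] [InnerProductSpace ℝ E] (b : HilbertBasis ι ℝ E)
    {f : α → E} (h : ∀ k, AEStronglyMeasurable (fun a => inner ℝ (f a) (b k)) μ) :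
    AEStronglyMeasurable f μ := by
  refine aestronglyMeasurable_of_tendsto_ae (u := (atTop : Filter (Finset ι)))
    (f := fun s a => ∑ k ∈ s, inner ℝ (f a) (b k) • b k) (fun s => ?_)
    (Eventually.of_forall fun a => ?_)
  · exact Finset.aestronglyMeasurable_fun_sum s fun k _ => (h k).smul_const _
  · have h1 : HasSum (fun k => inner ℝ (f a) (b k) • b k) (f a) := by
      convert b.hasSum_repr (f a) using 3
      rw [b.repr_apply_apply, real_inner_comm]
    exact h1

/-- Multiplication of an `L²` function by the indicator function of a measurable set. -/
def mask {d : ℕ} {S : Set (Torus d)} (hS : MeasurableSet S) : L2 d →L[ℝ] L2 d :=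
  LinearMap.mkContinuous
    { toFun := fun u => ((Lp.memLp u).indicator hS).toLp
      map_add' := fun u v => by
        rw [← MemLp.toLp_add]
        refine MemLp.toLp_congr _ _ ?_
        filter_upwards [Lp.coeFn_add u v] with x hx
        by_cases h : x ∈ S
        · simp only [indicator_of_mem h, Pi.add_apply, hx]
        · simp only [indicator_of_notMem h, Pi.add_apply, add_zero]
      map_smul' := fun c u => by
        rw [RingHom.id_apply, ← MemLp.toLp_const_smul]
        refine MemLp.toLp_congr _ _ ?_
        filter_upwards [Lp.coeFn_smul c u] with x hx
        by_cases h : x ∈ S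
        · simp only [indicator_of_mem h, Pi.smul_apply, hx]
        · simp only [indicator_of_notMem h, Pi.smul_apply, smul_zero] } 1
    (fun u => by
      rw [one_mul]
      refine Lp.norm_le_norm_of_ae_le ?_
      filter_upwards [((Lp.memLp u).indicator hS).coeFn_toLp] with x hx
      rw [LinearMap.coe_mk, AddHom.coe_mk, hx]
      exact norm_indicator_le_norm_self _ _)

lemma mask_coe {d : ℕ} {S : Set (Torus d)} (hS : MeasurableSet S) (u : L2 d) :
    mask hS u =ᵐ[volume] S.indicator u :=
  ((Lp.memLp u).indicator hS).coeFn_toLp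

lemma norm_mask_le {d : ℕ} {S : Set (Torus d)} (hS : MeasurableSet S) (u : L2 d) :
    ‖mask hS u‖ ≤ ‖u‖ := by
  refine Lp.norm_le_norm_of_ae_le ?_
  filter_upwards [mask_coe hS u] with x hx
  rw [hx]
  exact norm_indicator_le_norm_self _ _

lemma mask_nonneg {d : ℕ} {S : Set (Torus d)} (hS : MeasurableSet S) {u : L2 d} (hu : 0 ≤ u) :
    0 ≤ mask hS u := by
  rw [nonneg_iff] at hu ⊢
  filter_upwards [mask_coe hS u, hu] with x h1 h2
  rw [h1]
  exact indicator_apply_nonneg fun _ => h2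

lemma mask_le_self {d : ℕ} {S : Set (Torus d)} (hS : MeasurableSet S) {u : L2 d} (hu : 0 ≤ u) :
    0 ≤ u - mask hS u := by
  rw [nonneg_iff] at hu ⊢
  filter_upwards [mask_coe hS u, hu, Lp.coeFn_sub u (mask hS u)] with x h1 h2 h3
  rw [h3, Pi.sub_apply, h1]
  by_cases h : x ∈ S <;> simp [h, h2]

lemma inner_mask {d : ℕ} {S : Set (Torus d)} (hS : MeasurableSet S) (u v : L2 d) :
    inner ℝ (mask hS u) v = inner ℝ u (mask hS v) := by
  rw [L2.inner_def, L2.inner_def]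
  refine integral_congr_ae ?_
  filter_upwards [mask_coe hS u, mask_coe hS v] with x h1 h2
  rw [h1, h2]
  by_cases h : x ∈ S <;> simp [h]

/-- The coordinates of `1_A(s, ·) cas_k` are integrals over `x` of functions measurable in
`(s, x)`, hence measurable in `s`; the mask is self-adjoint, so it can be moved to the basis. -/
lemma aestronglyMeasurable_mask {d : ℕ} {A : Set (ℝ × Torus d)} (hA : MeasurableSet A)
    {μ : Measure ℝ} {c : ℝ → L2 d} (hc : AEStronglyMeasurable c μ) :
    AEStronglyMeasurable (fun s => mask (measurable_prodMk_left (x := s) hA) (c s)) μ := by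
  have h1 : ∀ k : Fin d → ℤ, AEStronglyMeasurable
      (fun s => mask (measurable_prodMk_left (x := s) hA) (casL2 k)) μ := by
    intro k
    refine aestronglyMeasurable_of_coord (hartley d) fun l => ?_
    have e : ∀ s, inner ℝ (mask (measurable_prodMk_left (x := s) hA) (casL2 k)) (hartley d l) =
        ∫ x, A.indicator (fun p : ℝ × Torus d => cas k p.2 * cas l p.2) (s, x) := by
      intro s
      rw [hartley_apply, inner_casL2]
      refine integral_congr_ae ?_
      filter_upwards [mask_coe (measurable_prodMk_left (x := s) hA) (casL2 k), casL2_coe k]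
        with x h1 h2
      rw [h1]
      by_cases h : (s, x) ∈ A <;> simp [h, h2]
    simp only [e]
    refine StronglyMeasurable.aestronglyMeasurable (StronglyMeasurable.integral_prod_right ?_)
    refine (Continuous.stronglyMeasurable ?_).indicator hA
    have := (cas_smooth k).continuous
    have := (cas_smooth l).continuous
    fun_prop
  refine aestronglyMeasurable_of_coord (hartley d) fun k => ?_
  simp only [inner_mask, hartley_apply]
  exact hc.inner (h1 k)

/-- The positive operator `u ↦ β ((1 - 1_A) u + (1_A u)(· - ξ))` at time `s`.  The zeroth-order
part of the equation is this operator minus `β`. -/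
def jump {d : ℕ} (β : ℝ) (ξ : Torus d) {A : Set (ℝ × Torus d)} (hA : MeasurableSet A) (s : ℝ) :
    L2 d →L[ℝ] L2 d :=
  β • (ContinuousLinearMap.id ℝ (L2 d) - mask (measurable_prodMk_left (x := s) hA) +
    (shift (-ξ)).toContinuousLinearMap.comp (mask (measurable_prodMk_left (x := s) hA)))

lemma jump_apply {d : ℕ} (β : ℝ) (ξ : Torus d) {A : Set (ℝ × Torus d)} (hA : MeasurableSet A)
    (s : ℝ) (u : L2 d) :
    jump β ξ hA s u = β • (u - mask (measurable_prodMk_left (x := s) hA) u +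
      shift (-ξ) (mask (measurable_prodMk_left (x := s) hA) u)) := rfl

lemma jump_nonneg {d : ℕ} {β : ℝ} (hβ : 0 ≤ β) (ξ : Torus d) {A : Set (ℝ × Torus d)}
    (hA : MeasurableSet A) (s : ℝ) {u : L2 d} (hu : 0 ≤ u) : 0 ≤ jump β ξ hA s u := by
  rw [jump_apply]
  exact smul_nonneg_L2 hβ (add_nonneg (mask_le_self _ hu) (shift_nonneg _ (mask_nonneg _ hu)))

lemma norm_jump_le {d : ℕ} {β : ℝ} (hβ : 0 ≤ β) (ξ : Torus d) {A : Set (ℝ × Torus d)}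
    (hA : MeasurableSet A) (s : ℝ) (u : L2 d) : ‖jump β ξ hA s u‖ ≤ 3 * β * ‖u‖ := by
  rw [jump_apply, norm_smul, Real.norm_of_nonneg hβ]
  have h1 := norm_mask_le (measurable_prodMk_left (x := s) hA) u
  have h2 := norm_add_le (u - mask (measurable_prodMk_left (x := s) hA) u)
    (shift (-ξ) (mask (measurable_prodMk_left (x := s) hA) u))
  have h3 := norm_sub_le u (mask (measurable_prodMk_left (x := s) hA) u)
  rw [LinearIsometry.norm_map] at h2
  calc _ ≤ β * (3 * ‖u‖) := mul_le_mul_of_nonneg_left (by linarith) hβ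
    _ = _ := by ring

lemma aestronglyMeasurable_jump {d : ℕ} (β : ℝ) (ξ : Torus d) {A : Set (ℝ × Torus d)}
    (hA : MeasurableSet A) {μ : Measure ℝ} {c : ℝ → L2 d} (hc : AEStronglyMeasurable c μ) :
    AEStronglyMeasurable (fun s => jump β ξ hA s (c s)) μ := by
  have h := aestronglyMeasurable_mask hA hc
  simp only [jump_apply]
  exact ((hc.sub h).add ((shift (-ξ)).continuous.comp_aestronglyMeasurable h)).const_smul β

/-! ### Duhamel's formula and its fixed point -/

lemma continuous_heat_comp {X : Type*} [TopologicalSpace X] {d : ℕ} {f : X → ℝ} {g : X → L2 d}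
    (hf : Continuous f) (hg : Continuous g) : Continuous fun x => heat (f x) (g x) := by
  have h := (continuous_heat d).comp (hf.prodMk hg)
  simpa only [Function.comp_def] using h

lemma aestronglyMeasurable_heat_comp {X : Type*} [MeasurableSpace X] {μ : Measure X} {d : ℕ}
    {f : X → ℝ} {g : X → L2 d} (hf : AEStronglyMeasurable f μ) (hg : AEStronglyMeasurable g μ) :
    AEStronglyMeasurable (fun x => heat (f x) (g x)) μ := by
  have h := (continuous_heat d).comp_aestronglyMeasurable (hf.prodMk hg)
  simpa only [Function.comp_def] using h

/-- The Duhamel integral `∫_0^t e^{-κ(t-s)} e^{ν(t-s)Δ} G(s) ds`. -/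
def duhamel {d : ℕ} (T ν κ : ℝ) (G : ℝ → L2 d) (t : ℝ) : L2 d :=
  ∫ s, (Iio t).indicator (fun s => Real.exp (-(κ * (t - s))) • heat (ν * (t - s)) (G s)) s
    ∂timeMeasure T

section duhamel

variable {d : ℕ} {T ν κ : ℝ} {G : ℝ → L2 d}

lemma aestronglyMeasurable_duhamel_integrand (hG : AEStronglyMeasurable G (timeMeasure T))
    (t : ℝ) : AEStronglyMeasurable ((Iio t).indicator
      fun s => Real.exp (-(κ * (t - s))) • heat (ν * (t - s)) (G s)) (timeMeasure T) := by
  refine AEStronglyMeasurable.indicator ?_ measurableSet_Iio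
  have h1 : AEStronglyMeasurable (fun s : ℝ => Real.exp (-(κ * (t - s)))) (timeMeasure T) :=
    Continuous.aestronglyMeasurable (by fun_prop)
  have h2 : AEStronglyMeasurable (fun s : ℝ => (ν * (t - s))) (timeMeasure T) :=
    Continuous.aestronglyMeasurable (by fun_prop)
  exact h1.smul (aestronglyMeasurable_heat_comp h2 hG)

lemma norm_duhamel_integrand_le (hκ : 0 ≤ κ) {C : ℝ}
    (hC : ∀ᵐ s ∂timeMeasure T, ‖G s‖ ≤ C) (t : ℝ) :
    ∀ᵐ s ∂timeMeasure T, ‖(Iio t).indicator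
      (fun s => Real.exp (-(κ * (t - s))) • heat (ν * (t - s)) (G s)) s‖ ≤ C := by
  filter_upwards [hC] with s hs
  by_cases h : s ∈ Iio t
  · rw [indicator_of_mem h, norm_smul, Real.norm_of_nonneg (Real.exp_nonneg _)]
    have h1 : Real.exp (-(κ * (t - s))) ≤ 1 := by
      rw [Real.exp_le_one_iff, neg_nonpos]
      exact mul_nonneg hκ (sub_nonneg.2 (le_of_lt h))
    calc _ ≤ 1 * ‖G s‖ := mul_le_mul h1 (norm_heat_le _ _) (norm_nonneg _) zero_le_one
      _ ≤ C := by rwa [one_mul]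
  · rw [indicator_of_notMem h, norm_zero]
    exact (norm_nonneg _).trans hs

lemma integrable_duhamel_integrand (hκ : 0 ≤ κ) (hG : AEStronglyMeasurable G (timeMeasure T))
    {C : ℝ} (hC : ∀ᵐ s ∂timeMeasure T, ‖G s‖ ≤ C) (t : ℝ) : Integrable ((Iio t).indicator
      fun s => Real.exp (-(κ * (t - s))) • heat (ν * (t - s)) (G s)) (timeMeasure T) :=
  Integrable.of_bound (aestronglyMeasurable_duhamel_integrand hG t) C
    (norm_duhamel_integrand_le hκ hC t)

lemma continuous_duhamel (hκ : 0 ≤ κ) (hG : AEStronglyMeasurable G (timeMeasure T))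
    {C : ℝ} (hC : ∀ᵐ s ∂timeMeasure T, ‖G s‖ ≤ C) : Continuous (duhamel T ν κ G) := by
  rw [continuous_iff_continuousAt]
  intro t₀
  refine continuousAt_of_dominated (bound := fun _ => C)
    (Eventually.of_forall fun t => aestronglyMeasurable_duhamel_integrand hG t)
    (Eventually.of_forall fun t => norm_duhamel_integrand_le hκ hC t) (integrable_const C) ?_
  have hne : ∀ᵐ s ∂timeMeasure T, s ≠ t₀ := ae_restrict_of_ae (Measure.ae_ne volume t₀)
  filter_upwards [hne] with s hs
  have hcont : Continuous fun t => Real.exp (-(κ * (t - s))) • heat (ν * (t - s)) (G s) := by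
    have h1 : Continuous fun t : ℝ => Real.exp (-(κ * (t - s))) := by fun_prop
    have h2 : Continuous fun t : ℝ => ν * (t - s) := by fun_prop
    exact h1.smul (continuous_heat_comp h2 continuous_const)
  rcases lt_or_gt_of_ne hs with h | h
  · refine hcont.continuousAt.congr ?_
    filter_upwards [lt_mem_nhds h] with t ht
    rw [indicator_of_mem (mem_Iio.2 ht)]
  · refine (continuousAt_const (y := (0 : L2 d))).congr ?_
    filter_upwards [gt_mem_nhds h] with t ht
    rw [indicator_of_notMem (by simpa using ht.le)]

lemma duhamel_nonneg (hG : ∀ᵐ s ∂timeMeasure T, 0 ≤ G s) (t : ℝ) : 0 ≤ duhamel T ν κ G t := by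
  refine integral_nonneg_of_ae ?_
  filter_upwards [hG] with s hs
  by_cases h : s ∈ Iio t
  · rw [indicator_of_mem h]
    exact smul_nonneg_L2 (Real.exp_nonneg _) (heat_nonneg _ hs)
  · rw [indicator_of_notMem h]; rfl

lemma integral_indicator_Iio {E : Type*} [NormedAddCommGroup E] [NormedSpace ℝ E] {t : ℝ}
    (ht : t ∈ Icc 0 T) (F : ℝ → E) :
    ∫ s, (Iio t).indicator F s ∂timeMeasure T = ∫ s in 0..t, F s := by
  rw [integral_indicator measurableSet_Iio, timeMeasure, Measure.restrict_restrict
    measurableSet_Iio, intervalIntegral.integral_of_le ht.1, integral_Ioc_eq_integral_Ioo]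
  congr 2
  ext s
  simp only [mem_inter_iff, mem_Iio, mem_Ioo]
  exact ⟨fun h => ⟨h.2.1, h.1⟩, fun h => ⟨h.2, h.1, h.2.trans_le ht.2⟩⟩

lemma inner_duhamel_casL2 (hν : 0 ≤ ν) (hκ : 0 ≤ κ)
    (hG : AEStronglyMeasurable G (timeMeasure T)) {C : ℝ}
    (hC : ∀ᵐ s ∂timeMeasure T, ‖G s‖ ≤ C) (k : Fin d → ℤ) {t : ℝ} (ht : t ∈ Icc 0 T) :
    inner ℝ (duhamel T ν κ G t) (casL2 k) = ∫ s in 0..t,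
      Real.exp (-((ν * eigenvalue k + κ) * (t - s))) * inner ℝ (G s) (casL2 k) := by
  rw [duhamel, real_inner_comm, ← integral_inner (integrable_duhamel_integrand hκ hG hC t),
    ← integral_indicator_Iio ht]
  refine integral_congr_ae (Eventually.of_forall fun s => ?_)
  by_cases h : s ∈ Iio t
  · simp only [indicator_of_mem h]
    rw [inner_smul_right, real_inner_comm,
      inner_heat_casL2 (mul_nonneg hν (sub_nonneg.2 (le_of_lt h))), ← mul_assoc, ← Real.exp_add]
    congr 2; ring
  · simp only [indicator_of_notMem h, inner_zero_right]

/-- The damping produces the factor `∫_0^t e^{-κ(t-s)} ds ≤ 1/κ`, uniformly in the time horizon. -/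
lemma norm_duhamel_sub_le (hκ : 0 < κ) {G' : ℝ → L2 d}
    (hG : AEStronglyMeasurable G (timeMeasure T)) (hG' : AEStronglyMeasurable G' (timeMeasure T))
    {C C' D : ℝ} (hC : ∀ᵐ s ∂timeMeasure T, ‖G s‖ ≤ C) (hC' : ∀ᵐ s ∂timeMeasure T, ‖G' s‖ ≤ C')
    (hD : 0 ≤ D) (hGG : ∀ᵐ s ∂timeMeasure T, ‖G s - G' s‖ ≤ D) {t : ℝ} (ht : t ∈ Icc 0 T) :
    ‖duhamel T ν κ G t - duhamel T ν κ G' t‖ ≤ D / κ := by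
  have hexp : ∫ s in 0..t, Real.exp (-(κ * (t - s))) * D = (1 - Real.exp (-(κ * t))) / κ * D := by
    rw [intervalIntegral.integral_mul_const]
    congr 1
    have hd : ∀ s, HasDerivAt (fun s => Real.exp (-(κ * (t - s))) / κ)
        (Real.exp (-(κ * (t - s)))) s := by
      intro s
      have h1 : HasDerivAt (fun s => -(κ * (t - s))) κ s := by
        simpa using (((hasDerivAt_id s).const_sub t).const_mul κ).fun_neg
      have h2 := h1.exp.div_const κ
      rwa [mul_div_cancel_right₀ _ hκ.ne'] at h2
    rw [intervalIntegral.integral_eq_sub_of_hasDerivAt (fun s _ => hd s)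
      (Continuous.intervalIntegrable (by fun_prop) _ _)]
    simp only [sub_self, mul_zero, neg_zero, Real.exp_zero, sub_zero]
    ring
  have hle : ‖duhamel T ν κ G t - duhamel T ν κ G' t‖ ≤
      ∫ s, (Iio t).indicator (fun s => Real.exp (-(κ * (t - s))) * D) s ∂timeMeasure T := by
    rw [duhamel, duhamel, ← integral_sub (integrable_duhamel_integrand hκ.le hG hC t)
      (integrable_duhamel_integrand hκ.le hG' hC' t)]
    refine norm_integral_le_of_norm_le ?_ ?_
    · refine Integrable.indicator ?_ measurableSet_Iio
      exact integrable_timeMeasure_of_continuousOn (Continuous.continuousOn (by fun_prop))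
    · filter_upwards [hGG] with s hs
      by_cases h : s ∈ Iio t
      · simp only [indicator_of_mem h]
        rw [← smul_sub, ← heat_sub, norm_smul, Real.norm_of_nonneg (Real.exp_nonneg _)]
        exact mul_le_mul_of_nonneg_left ((norm_heat_le _ _).trans hs) (Real.exp_nonneg _)
      · simp only [indicator_of_notMem h, sub_zero, norm_zero, le_refl]
  rw [integral_indicator_Iio ht, hexp] at hle
  refine hle.trans ?_
  rw [div_mul_eq_mul_div, div_le_div_iff_of_pos_right hκ]
  nlinarith [Real.exp_nonneg (-(κ * t))]

end duhamel

/-- The right-hand side of Duhamel's formula for `∂_t n = νΔn - κn + B(t)n`, `n(0) = u₀`. -/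
def picard {d : ℕ} (T ν κ : ℝ) (B : ℝ → L2 d →L[ℝ] L2 d) (u₀ : L2 d) (n : ℝ → L2 d) (t : ℝ) :
    L2 d :=
  Real.exp (-(κ * t)) • heat (ν * t) u₀ + duhamel T ν κ (fun s => B s (n s)) t

section picard

variable {d : ℕ} {T ν κ M : ℝ} {B : ℝ → L2 d →L[ℝ] L2 d} {u₀ : L2 d}

lemma exists_bound_timeMeasure {n : ℝ → L2 d} (hB : ∀ s u, ‖B s u‖ ≤ M * ‖u‖) (hM : 0 ≤ M)
    (hn : ContinuousOn n (Icc 0 T)) :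
    ∃ C, ∀ᵐ s ∂timeMeasure T, ‖B s (n s)‖ ≤ C := by
  obtain ⟨C, hC⟩ := isCompact_Icc.exists_bound_of_continuousOn hn
  refine ⟨M * C, ?_⟩
  filter_upwards [ae_restrict_mem measurableSet_Ioo] with s hs
  exact (hB s _).trans (mul_le_mul_of_nonneg_left (hC s (Ioo_subset_Icc_self hs)) hM)

/-- Since `‖B‖ ≤ M < κ`, the map `picard` is a contraction of `C([0,T], L²)`; if `B` and `u₀` are
nonnegative it preserves the closed cone of nonnegative functions, so that its fixed point is
nonnegative. -/
lemma exists_unique_picard (hT : 0 ≤ T) (hM : 0 ≤ M) (hMκ : M < κ)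
    (hB : ∀ s u, ‖B s u‖ ≤ M * ‖u‖)
    (hBm : ∀ c : ℝ → L2 d, AEStronglyMeasurable c (timeMeasure T) →
      AEStronglyMeasurable (fun s => B s (c s)) (timeMeasure T))
    (hB0 : ∀ s u, 0 ≤ u → 0 ≤ B s u) (hu₀ : 0 ≤ u₀) :
    ∃ n : ℝ → L2 d, ContinuousOn n (Icc 0 T) ∧ (∀ t ∈ Icc 0 T, n t = picard T ν κ B u₀ n t) ∧
      (∀ t ∈ Icc 0 T, 0 ≤ n t) ∧
      ∀ n' : ℝ → L2 d, ContinuousOn n' (Icc 0 T) →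
        (∀ t ∈ Icc 0 T, n' t = picard T ν κ B u₀ n' t) → EqOn n' n (Icc 0 T) := by
  have hκ : 0 < κ := hM.trans_lt hMκ
  have meas : ∀ {n : ℝ → L2 d}, ContinuousOn n (Icc 0 T) →
      AEStronglyMeasurable (fun s => B s (n s)) (timeMeasure T) := fun hn =>
    hBm _ (aestronglyMeasurable_timeMeasure_of_continuousOn hn)
  have cont : ∀ {n : ℝ → L2 d}, ContinuousOn n (Icc 0 T) → Continuous (picard T ν κ B u₀ n) := by
    intro n hn
    obtain ⟨C, hC⟩ := exists_bound_timeMeasure hB hM hn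
    have h1 : Continuous fun t : ℝ => Real.exp (-(κ * t)) := by fun_prop
    have h2 : Continuous fun t : ℝ => ν * t := by fun_prop
    exact (h1.smul (continuous_heat_comp h2 continuous_const)).add
      (continuous_duhamel hκ.le (meas hn) hC)
  have ext : ∀ n : C(Icc 0 T, L2 d), ContinuousOn (IccExtend hT n) (Icc 0 T) := fun n =>
    (n.continuous.Icc_extend').continuousOn
  have congr : ∀ {n n' : ℝ → L2 d}, EqOn n n' (Icc 0 T) →
      ∀ t, picard T ν κ B u₀ n t = picard T ν κ B u₀ n' t := by
    intro n n' h t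
    rw [picard, picard, duhamel, duhamel]
    congr 1
    refine integral_congr_ae ?_
    filter_upwards [ae_restrict_mem measurableSet_Ioo] with s hs
    by_cases hst : s ∈ Iio t
    · simp only [indicator_of_mem hst, h (Ioo_subset_Icc_self hs)]
    · simp only [indicator_of_notMem hst]
  let Φ : C(Icc 0 T, L2 d) → C(Icc 0 T, L2 d) := fun n =>
    ⟨fun t => picard T ν κ B u₀ (IccExtend hT n) t, (cont (ext n)).comp continuous_subtype_val⟩
  have hK : 0 ≤ M / κ := by positivity
  have hΦ : ContractingWith (M / κ).toNNReal Φ := by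
    refine ⟨by rw [Real.toNNReal_lt_one]; exact (div_lt_one hκ).2 hMκ,
      LipschitzWith.of_dist_le_mul fun n n' => ?_⟩
    rw [Real.coe_toNNReal _ hK, ContinuousMap.dist_le (by positivity)]
    intro t
    obtain ⟨C, hC⟩ := exists_bound_timeMeasure hB hM (ext n)
    obtain ⟨C', hC'⟩ := exists_bound_timeMeasure hB hM (ext n')
    have h1 := norm_duhamel_sub_le (ν := ν) hκ (meas (ext n)) (meas (ext n')) hC hC'
      (D := M * dist n n') (by positivity) (by
        filter_upwards [ae_restrict_mem measurableSet_Ioo] with s hs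
        rw [← map_sub]
        refine (hB s _).trans (mul_le_mul_of_nonneg_left ?_ hM)
        rw [← dist_eq_norm, IccExtend_of_mem _ _ (Ioo_subset_Icc_self hs),
          IccExtend_of_mem _ _ (Ioo_subset_Icc_self hs)]
        exact ContinuousMap.dist_apply_le_dist _) t.2
    have e : dist (Φ n t) (Φ n' t) = ‖duhamel T ν κ (fun s => B s (IccExtend hT n s)) t -
        duhamel T ν κ (fun s => B s (IccExtend hT n' s)) t‖ := by
      rw [dist_eq_norm]
      simp only [Φ, ContinuousMap.coe_mk, picard, add_sub_add_left_eq_sub]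
    rw [e]
    exact h1.trans (le_of_eq (by ring))
  let cone : Set C(Icc 0 T, L2 d) := {n | ∀ t, 0 ≤ n t}
  have hcl : IsClosed cone := by
    have : cone = ⋂ t, {n | 0 ≤ n t} := by ext n; simp [cone]
    rw [this]
    exact isClosed_iInter fun t => isClosed_le continuous_const (continuous_eval_const t)
  have hmaps : MapsTo Φ cone cone := by
    intro n hn t
    refine add_nonneg (smul_nonneg_L2 (Real.exp_nonneg _) (heat_nonneg _ hu₀))
      (duhamel_nonneg ?_ _)
    exact Eventually.of_forall fun s => hB0 s _ (hn _)
  obtain ⟨n, hn, hfix, -⟩ := ContractingWith.exists_fixedPoint' hcl.isComplete hmaps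
    (hΦ.restrict hmaps) (x := 0) (fun t => le_rfl) (edist_ne_top _ _)
  have hev : ∀ t (ht : t ∈ Icc 0 T), n ⟨t, ht⟩ = picard T ν κ B u₀ (IccExtend hT n) t :=
    fun t ht => (DFunLike.congr_fun hfix ⟨t, ht⟩).symm
  refine ⟨IccExtend hT n, ext n, fun t ht => ?_, fun t ht => ?_, fun n' hn' hfix' t ht => ?_⟩
  · rw [IccExtend_of_mem _ _ ht, hev t ht]
  · rw [IccExtend_of_mem _ _ ht]; exact hn _
  · let N : C(Icc 0 T, L2 d) := ⟨(Icc 0 T).domRestrict n', hn'.domRestrict⟩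
    have hN : EqOn (IccExtend hT N) n' (Icc 0 T) := fun s hs => by
      rw [IccExtend_of_mem _ _ hs]; rfl
    have hNfix : Function.IsFixedPt Φ N := by
      ext1 s
      refine (congr hN s).trans (hfix' s s.2).symm
    have := hΦ.fixedPoint_unique' hNfix hfix
    rw [IccExtend_of_mem _ _ ht, ← this]
    rfl

end picard

/-! ### Parseval's identity for time-dependent functions -/

section parseval

variable {α ι E : Type*} [MeasurableSpace α] {μ : Measure α}
  [NormedAddCommGroup E] [InnerProductSpace ℝ E] (b : HilbertBasis ι ℝ E)

lemma memLp_inner_const {u : α → E} (hu : MemLp u 2 μ) (v : E) :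
    MemLp (fun t => inner ℝ (u t) v) 2 μ := by
  refine (hu.norm.mul_const ‖v‖).mono (hu.aestronglyMeasurable.inner aestronglyMeasurable_const)
    (Eventually.of_forall fun t => ?_)
  rw [Real.norm_of_nonneg (r := ‖u t‖ * ‖v‖) (by positivity)]
  exact norm_inner_le_norm _ _

lemma summable_integral_coord_sq {u : α → E} (hu : MemLp u 2 μ) :
    Summable fun k => ∫ t, inner ℝ (u t) (b k) ^ 2 ∂μ := by
  refine summable_of_sum_le (c := ∫ t, ‖u t‖ ^ 2 ∂μ)
    (fun k => integral_nonneg fun t => sq_nonneg _) fun s => ?_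
  rw [← integral_finsetSum _ fun k _ => (memLp_inner_const hu (b k)).integrable_sq]
  refine integral_mono (integrable_finsetSum _ fun k _ =>
    (memLp_inner_const hu (b k)).integrable_sq) hu.norm.integrable_sq fun t => ?_
  have := b.orthonormal.sum_inner_products_le (u t) (s := s)
  simpa only [Real.norm_eq_abs, sq_abs, real_inner_comm] using this

/-- Parseval's identity, integrated; `|u_k v_k| ≤ u_k² + v_k²` allows the exchange of sum and
integral. -/
lemma hasSum_integral_coord_mul [Countable ι] {u v : α → E} (hu : MemLp u 2 μ)
    (hv : MemLp v 2 μ) :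
    HasSum (fun k => ∫ t, inner ℝ (u t) (b k) * inner ℝ (v t) (b k) ∂μ)
      (∫ t, inner ℝ (u t) (v t) ∂μ) := by
  have hint : ∀ k, Integrable (fun t => inner ℝ (u t) (b k) * inner ℝ (v t) (b k)) μ :=
    fun k => (memLp_inner_const hu (b k)).integrable_mul (memLp_inner_const hv (b k))
  have h := hasSum_integral_of_summable_integral_norm hint (by
    refine Summable.of_nonneg_of_le (fun k => integral_nonneg fun t => norm_nonneg _)
      (fun k => ?_) ((summable_integral_coord_sq b hu).add (summable_integral_coord_sq b hv))
    rw [← integral_add (memLp_inner_const hu (b k)).integrable_sq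
      (memLp_inner_const hv (b k)).integrable_sq]
    refine integral_mono (hint k).norm ((memLp_inner_const hu (b k)).integrable_sq.add
      (memLp_inner_const hv (b k)).integrable_sq) fun t => ?_
    simp only [norm_mul, Real.norm_eq_abs]
    rw [← sq_abs (inner ℝ (u t) (b k)), ← sq_abs (inner ℝ (v t) (b k))]
    nlinarith [sq_nonneg (|inner ℝ (u t) (b k)| - |inner ℝ (v t) (b k)|),
      sq_nonneg (|inner ℝ (u t) (b k)| + |inner ℝ (v t) (b k)|)])
  have e : ∀ t, ∑' k, inner ℝ (u t) (b k) * inner ℝ (v t) (b k) = inner ℝ (u t) (v t) := by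
    intro t
    have := (b.hasSum_inner_mul_inner (u t) (v t)).tsum_eq
    simpa only [real_inner_comm (v t)] using this
  simpa only [e] using h

/-- Monotone convergence: a series of nonnegative functions whose integrals are summable converges
almost everywhere, to an integrable function. -/
lemma ae_summable_of_summable_integral [Countable ι] {g : ι → α → ℝ} (h0 : ∀ k t, 0 ≤ g k t)
    (hg : ∀ k, Integrable (g k) μ) (hs : Summable fun k => ∫ t, g k t ∂μ) :
    (∀ᵐ t ∂μ, Summable fun k => g k t) ∧ Integrable (fun t => ∑' k, g k t) μ := by
  have hm : ∀ k, AEMeasurable (fun t => ENNReal.ofReal (g k t)) μ :=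
    fun k => (hg k).aestronglyMeasurable.aemeasurable.ennreal_ofReal
  have hfin : ∫⁻ t, ∑' k, ENNReal.ofReal (g k t) ∂μ ≠ ⊤ := by
    rw [lintegral_tsum hm]
    have : ∀ k, ∫⁻ t, ENNReal.ofReal (g k t) ∂μ = ENNReal.ofReal (∫ t, g k t ∂μ) := fun k =>
      (ofReal_integral_eq_lintegral_ofReal (hg k) (Eventually.of_forall (h0 k))).symm
    simp only [this]
    exact hs.tsum_ofReal_ne_top
  have hsum : ∀ᵐ t ∂μ, Summable fun k => g k t := by
    filter_upwards [ae_lt_top' (AEMeasurable.tsum hm) hfin] with t ht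
    have := ENNReal.summable_toReal ht.ne
    simpa only [ENNReal.toReal_ofReal (h0 _ _)] using this
  refine ⟨hsum, (integrable_toReal_of_lintegral_ne_top (AEMeasurable.tsum hm) hfin).congr
    (Eventually.of_forall fun t => ?_)⟩
  simp only
  rw [ENNReal.tsum_toReal_eq fun _ => ENNReal.ofReal_ne_top]
  simp only [ENNReal.toReal_ofReal (h0 _ _)]

end parseval

/-! ### Lifting to `L²((0,T), H¹)` -/

lemma memLp_of_bound_timeMeasure {E : Type*} [NormedAddCommGroup E] {T : ℝ} {f : ℝ → E}
    (hf : AEStronglyMeasurable f (timeMeasure T)) {C : ℝ}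
    (hC : ∀ᵐ t ∂timeMeasure T, ‖f t‖ ≤ C) : MemLp f 2 (timeMeasure T) :=
  MemLp.of_bound hf C hC

lemma memLp_of_continuousOn {E : Type*} [NormedAddCommGroup E] {T : ℝ} {f : ℝ → E}
    (hf : ContinuousOn f (Icc 0 T)) : MemLp f 2 (timeMeasure T) := by
  obtain ⟨C, hC⟩ := isCompact_Icc.exists_bound_of_continuousOn hf
  refine MemLp.of_bound (aestronglyMeasurable_timeMeasure_of_continuousOn hf) C ?_
  filter_upwards [ae_restrict_mem measurableSet_Ioo] with s hs
  exact hC s (Ioo_subset_Icc_self hs)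

/-- If `∑ (1 + λ_k) u_k²` converges, then `u` lies in `H¹`, with that sum as its squared norm. -/
lemma hasSum_casH1 {d : ℕ} (u : L2 d)
    (h : Summable fun k => (1 + eigenvalue k) * inner ℝ u (casL2 k) ^ 2) :
    ∃ z : H1 d, HasSum (fun k => inner ℝ u (casL2 k) • casH1 k) z ∧ toL2 d z = u ∧
      ‖z‖ ^ 2 = ∑' k, (1 + eigenvalue k) * inner ℝ u (casL2 k) ^ 2 := by
  have hsq : ∀ k : Fin d → ℤ, ‖Real.sqrt (1 + eigenvalue k) * inner ℝ u (casL2 k)‖ ^ 2 =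
      (1 + eigenvalue k) * inner ℝ u (casL2 k) ^ 2 := by
    intro k
    rw [Real.norm_eq_abs, sq_abs, mul_pow, Real.sq_sqrt (one_add_eigenvalue_pos k).le]
  have hmem : Memℓp (fun k : Fin d → ℤ => Real.sqrt (1 + eigenvalue k) * inner ℝ u (casL2 k)) 2 := by
    rw [memℓp_gen_iff (by simp)]
    simpa only [ENNReal.toReal_ofNat, Real.rpow_two, hsq] using h
  let F : lp (fun _ : Fin d → ℤ => ℝ) 2 := ⟨_, hmem⟩
  have hF : HasSum (fun k => inner ℝ u (casL2 k) • casH1 k) ((hartleyH1 d).repr.symm F) := by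
    have h1 := (hartleyH1 d).hasSum_repr_symm F
    have e : (fun k => inner ℝ u (casL2 k) • casH1 k) = fun k => F k • hartleyH1 d k := by
      funext k
      have hF : F k = Real.sqrt (1 + eigenvalue k) * inner ℝ u (casL2 k) := rfl
      rw [hartleyH1_apply, hF, smul_smul, mul_right_comm,
        mul_inv_cancel₀ (Real.sqrt_pos.2 (one_add_eigenvalue_pos k)).ne', one_mul]
    rw [e]
    exact h1
  refine ⟨(hartleyH1 d).repr.symm F, hF, ?_, ?_⟩
  · have h2 := hF.mapL (toL2 d)
    simp only [map_smul, toL2_casH1] at h2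
    have h3 := (hartley d).hasSum_repr u
    simp only [HilbertBasis.repr_apply_apply, hartley_apply, real_inner_comm u] at h3
    exact h2.unique h3
  · have h4 := lp.norm_rpow_eq_tsum (p := 2) (by simp) F
    simp only [ENNReal.toReal_ofNat, Real.rpow_two] at h4
    rw [LinearIsometryEquiv.norm_map, h4]
    exact tsum_congr hsq

/-- The partial sums `∑ c_k(t) cas_k`, which are measurable in `t`, converge in `H¹` for almost every
`t`, to a function of square integrable norm. -/
lemma exists_lift_H1 {d : ℕ} {T : ℝ} {c : ℝ → L2 d} (hc : MemLp c 2 (timeMeasure T))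
    (hs : Summable fun k => (1 + eigenvalue k) * ∫ t, inner ℝ (c t) (casL2 k) ^ 2 ∂timeMeasure T) :
    ∃ m : L2Time T (H1 d), ∀ᵐ t ∂timeMeasure T, toL2 d (m t) = c t := by
  obtain ⟨hsum, hint⟩ := ae_summable_of_summable_integral (μ := timeMeasure T)
    (g := fun (k : Fin d → ℤ) t => (1 + eigenvalue k) * inner ℝ (c t) (casL2 k) ^ 2)
    (fun k t => mul_nonneg (one_add_eigenvalue_pos k).le (sq_nonneg _))
    (fun k => (memLp_inner_const hc (casL2 k)).integrable_sq.const_mul _)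
    (by simpa only [integral_const_mul] using hs)
  set M : ℝ → H1 d := fun t => ∑' k, inner ℝ (c t) (casL2 k) • casH1 k with hM
  have key : ∀ᵐ t ∂timeMeasure T, HasSum (fun k => inner ℝ (c t) (casL2 k) • casH1 k) (M t) ∧
      toL2 d (M t) = c t ∧
      ‖M t‖ ^ 2 = ∑' k, (1 + eigenvalue k) * inner ℝ (c t) (casL2 k) ^ 2 := by
    filter_upwards [hsum] with t ht
    obtain ⟨z, hz1, hz2, hz3⟩ := hasSum_casH1 (c t) ht
    have : M t = z := hz1.tsum_eq
    rw [this]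
    exact ⟨hz1, hz2, hz3⟩
  have hMm : AEStronglyMeasurable M (timeMeasure T) := by
    refine aestronglyMeasurable_of_tendsto_ae (u := (atTop : Filter (Finset (Fin d → ℤ))))
      (f := fun s t => ∑ k ∈ s, inner ℝ (c t) (casL2 k) • casH1 k) (fun s => ?_)
      (key.mono fun t ht => ht.1)
    exact Finset.aestronglyMeasurable_fun_sum s fun k _ =>
      (memLp_inner_const hc (casL2 k)).aestronglyMeasurable.smul_const _
  have hMp : MemLp M 2 (timeMeasure T) := by
    rw [memLp_two_iff_integrable_sq_norm hMm]
    exact hint.congr (key.mono fun t ht => ht.2.2.symm)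
  refine ⟨hMp.toLp, ?_⟩
  filter_upwards [hMp.coeFn_toLp, key] with t h1 h2
  rw [h1, h2.2.1]

/-! ### Test functions on `(0,T) × T^d` and the weak formulation -/

/-- `φ ∈ C^∞(ℝ × T^d)`: the periodic lift of `φ` is smooth. -/
def SmoothSpaceTime {d : ℕ} (φ : ℝ × Torus d → ℝ) : Prop :=
  ContDiff ℝ ∞ (fun p : ℝ × (Fin d → ℝ) => φ (p.1, proj p.2))

namespace SmoothSpaceTime

variable {d : ℕ} {φ : ℝ × Torus d → ℝ}

lemma continuous (h : SmoothSpaceTime φ) : Continuous φ :=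
  (IsOpenQuotientMap.id.prodMap (proj_isOpenQuotientMap d)).isQuotientMap.continuous_iff.2
    (ContDiff.continuous h)

lemma slice (h : SmoothSpaceTime φ) (t : ℝ) : SmoothOnTorus fun x => φ (t, x) :=
  ContDiff.comp (g := fun p : ℝ × (Fin d → ℝ) => φ (p.1, proj p.2)) h
    (contDiff_const.prodMk contDiff_id)

lemma hasDerivAt_time (h : SmoothSpaceTime φ) (t : ℝ) (y : Fin d → ℝ) :
    HasDerivAt (fun s => φ (s, proj y))
      (fderiv ℝ (fun p : ℝ × (Fin d → ℝ) => φ (p.1, proj p.2)) (t, y) (1, 0)) t := by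
  have h1 := ((ContDiff.differentiable h (by simp)) (t, y)).hasFDerivAt
  have h2 : HasDerivAt (fun s : ℝ => (s, y)) ((1 : ℝ), (0 : Fin d → ℝ)) t :=
    (hasDerivAt_id t).prodMk (hasDerivAt_const t y)
  exact h1.comp_hasDerivAt t h2

lemma timeDeriv (h : SmoothSpaceTime φ) :
    SmoothSpaceTime fun p => deriv (fun s => φ (s, p.2)) p.1 := by
  unfold SmoothSpaceTime
  simp only [(h.hasDerivAt_time _ _).deriv]
  exact (ContDiff.fderiv_right (m := ∞) h (by simp)).clm_apply contDiff_const

lemma spaceDeriv (h : SmoothSpaceTime φ) (i : Fin d) :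
    SmoothSpaceTime fun p => partialDeriv i (fun x => φ (p.1, x)) p.2 := by
  unfold SmoothSpaceTime
  have e : ∀ p : ℝ × (Fin d → ℝ), partialDeriv i (fun x => φ (p.1, x)) (proj p.2) =
      fderiv ℝ (fun p : ℝ × (Fin d → ℝ) => φ (p.1, proj p.2)) p (0, Pi.single i 1) := by
    intro p
    rw [partialDeriv_proj (h.slice p.1)]
    have h1 := ((ContDiff.differentiable h (by simp)) p).hasFDerivAt
    have h2 : HasFDerivAt (fun y : Fin d → ℝ => (p.1, y))
        (ContinuousLinearMap.inr ℝ ℝ (Fin d → ℝ)) p.2 := hasFDerivAt_prodMk_right p.1 p.2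
    have h3 := (HasFDerivAt.comp p.2 (g := fun p : ℝ × (Fin d → ℝ) => φ (p.1, proj p.2)) h1 h2)
    have h4 : fderiv ℝ (fun y : Fin d → ℝ => φ (p.1, proj y)) p.2 = _ := h3.fderiv
    rw [h4]
    rfl
  simp only [e]
  exact (ContDiff.fderiv_right (m := ∞) h (by simp)).clm_apply contDiff_const

lemma laplacian_continuous (h : SmoothSpaceTime φ) :
    Continuous fun p : ℝ × Torus d => laplacian (fun x => φ (p.1, x)) p.2 :=
  continuous_finsetSum _ fun i _ => ((h.spaceDeriv i).spaceDeriv i).continuous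

lemma hasDerivAt (h : SmoothSpaceTime φ) (t : ℝ) (x : Torus d) :
    HasDerivAt (fun s => φ (s, x)) (deriv (fun s => φ (s, x)) t) t := by
  obtain ⟨y, rfl⟩ := proj_surjective d x
  have := h.hasDerivAt_time t y
  rwa [this.deriv]

end SmoothSpaceTime

/-- The time slice of a continuous function on `ℝ × T^d`, as an element of `L²(T^d)`. -/
def sliceL2 {d : ℕ} {ψ : ℝ × Torus d → ℝ} (hψ : Continuous ψ) (t : ℝ) : L2 d :=
  contL2 (fun x => ψ (t, x)) (hψ.comp (Continuous.prodMk_right t))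

lemma continuous_sliceL2 {d : ℕ} {ψ : ℝ × Torus d → ℝ} (hψ : Continuous ψ) :
    Continuous (sliceL2 hψ) :=
  (ContinuousMap.toLp (E := ℝ) 2 (volume : Measure (Torus d)) ℝ).continuous.comp
    (ContinuousMap.curry ⟨ψ, hψ⟩).continuous

lemma inner_sliceL2 {d : ℕ} {ψ : ℝ × Torus d → ℝ} (hψ : Continuous ψ) (t : ℝ) (u : L2 d) :
    inner ℝ u (sliceL2 hψ t) = ∫ x, u x * ψ (t, x) := inner_contL2 _ _ _

lemma inner_sliceL2_casL2 {d : ℕ} {ψ : ℝ × Torus d → ℝ} (hψ : Continuous ψ) (t : ℝ)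
    (k : Fin d → ℤ) : inner ℝ (sliceL2 hψ t) (casL2 k) = ∫ x, ψ (t, x) * cas k x := by
  rw [real_inner_comm, inner_sliceL2]
  refine integral_congr_ae ?_
  filter_upwards [casL2_coe k] with x hx
  rw [hx, mul_comm]

lemma memLp_sliceL2 {d : ℕ} {ψ : ℝ × Torus d → ℝ} (hψ : Continuous ψ) (T : ℝ) :
    MemLp (sliceL2 hψ) 2 (timeMeasure T) :=
  memLp_of_continuousOn (continuous_sliceL2 hψ).continuousOn

lemma IsTest.smooth {d : ℕ} {T : ℝ} {φ : ℝ × Torus d → ℝ} (h : IsTest T φ) :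
    SmoothSpaceTime φ := h.1

lemma IsTest.eq_zero {d : ℕ} {T : ℝ} {φ : ℝ × Torus d → ℝ} (h : IsTest T φ) {t : ℝ}
    (ht : t ∉ Ioo 0 T) (x : Torus d) : φ (t, x) = 0 :=
  image_eq_zero_of_notMem_tsupport fun hx => ht (h.2.2 hx).1

lemma IsTest.hasDerivAt_coord {d : ℕ} {T : ℝ} {φ : ℝ × Torus d → ℝ} (h : IsTest T φ)
    (k : Fin d → ℤ) (t : ℝ) :
    HasDerivAt (fun s => inner ℝ (sliceL2 h.smooth.continuous s) (casL2 k))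
      (inner ℝ (sliceL2 h.smooth.timeDeriv.continuous t) (casL2 k)) t := by
  have hk := (cas_smooth k).continuous
  have hφ := h.smooth.continuous
  have hφ' := h.smooth.timeDeriv.continuous
  have hc : Continuous fun p : ℝ × Torus d => deriv (fun s => φ (s, p.2)) p.1 * cas k p.2 :=
    hφ'.mul (hk.comp continuous_snd)
  -- outside `[0,T]` the time derivative vanishes, so it is bounded by compactness
  obtain ⟨C, hC⟩ := ((isCompact_Icc (a := (0 : ℝ)) (b := T)).prod
    (isCompact_univ (X := Torus d))).exists_bound_of_continuousOn hc.continuousOn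
  have hC' : ∀ s x, ‖deriv (fun s => φ (s, x)) s * cas k x‖ ≤ max C 0 := by
    intro s x
    by_cases hs : s ∈ Icc 0 T
    · exact (hC (s, x) ⟨hs, mem_univ _⟩).trans (le_max_left _ _)
    · have h0 : (fun s => φ (s, x)) =ᶠ[𝓝 s] fun _ => 0 := by
        filter_upwards [isClosed_Icc.isOpen_compl.mem_nhds hs] with r hr
        exact h.eq_zero (fun hr' => hr (Ioo_subset_Icc_self hr')) x
      rw [h0.deriv_eq]
      simp
  simp only [inner_sliceL2_casL2]
  exact hasDerivAt_integral_torus (F := fun s x => φ (s, x) * cas k x)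
    (F' := fun s x => deriv (fun s => φ (s, x)) s * cas k x)
    (fun s => (hφ.comp (Continuous.prodMk_right s)).mul hk)
    (fun s => (hφ'.comp (Continuous.prodMk_right s)).mul hk) hC'
    (fun s x => (h.smooth.hasDerivAt s x).mul_const _) t

lemma inner_laplacian_casL2 {d : ℕ} {φ : ℝ × Torus d → ℝ} (h : SmoothSpaceTime φ)
    (k : Fin d → ℤ) (t : ℝ) :
    inner ℝ (sliceL2 h.laplacian_continuous t) (casL2 k) =
      - eigenvalue k * inner ℝ (sliceL2 h.continuous t) (casL2 k) := by
  rw [inner_sliceL2_casL2, inner_sliceL2_casL2, ← integral_mul_laplacian (h.slice t) (cas_smooth k),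
    ← integral_const_mul]
  refine integral_congr_ae (Eventually.of_forall fun x => ?_)
  simp only [laplacian_cas]
  ring

/-- The zeroth-order term `-β 1_A u + β (1_A u)(· - ξ)` of the equation, at time `s`. -/
def source {d : ℕ} (β : ℝ) (ξ : Torus d) {A : Set (ℝ × Torus d)} (hA : MeasurableSet A) (s : ℝ)
    (u : L2 d) : L2 d := jump β ξ hA s u - β • u

lemma source_coe {d : ℕ} (β : ℝ) (ξ : Torus d) {A : Set (ℝ × Torus d)} (hA : MeasurableSet A)
    (s : ℝ) (u : L2 d) : ∀ᵐ x, source β ξ hA s u x =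
      -(β * (ind A s x * u x)) + β * (ind A s (x - ξ) * u (x - ξ)) := by
  set S := measurable_prodMk_left (x := s) hA
  have hind : ∀ x, (Prod.mk s ⁻¹' A).indicator u x = ind A s x * u x := by
    intro x
    by_cases h : (s, x) ∈ A <;> simp [ind, h]
  have e : source β ξ hA s u = β • (shift (-ξ) (mask S u) - mask S u) := by
    rw [source, jump_apply, ← smul_sub]
    congr 1
    abel
  rw [e]
  filter_upwards [Lp.coeFn_smul β (shift (-ξ) (mask S u) - mask S u),
    Lp.coeFn_sub (shift (-ξ) (mask S u)) (mask S u), shift_coe (-ξ) (mask S u), mask_coe S u,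
    ae_shift (mask_coe S u) (-ξ)] with x h1 h2 h3 h4 h5
  have hx : -ξ + x = x - ξ := by abel
  rw [h1, Pi.smul_apply, h2, Pi.sub_apply, h3, h5, h4, hind, hind, hx, smul_eq_mul]
  ring

/-- The integral over the torus in the weak formulation, written with inner products of `L²(T^d)`.
The set `A` may be replaced by a measurable set `A'`: almost every time slice changes by a null
set, and so does its translate by `ξ`. -/
lemma ae_integral_eq {d : ℕ} {T ν ε : ℝ} {ξ : Torus d} {A A' : Set (ℝ × Torus d)}
    (hA' : MeasurableSet A') (hAA' : A' =ᵐ[(timeMeasure T).prod volume] A)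
    (u : ℝ → L2 d) {φ : ℝ × Torus d → ℝ} (h : SmoothSpaceTime φ) :
    ∀ᵐ t ∂timeMeasure T, ∫ x : Torus d,
      (u t x * (-(deriv (fun s => φ (s, x)) t) - ν * laplacian (fun z => φ (t, z)) x)
        + ε⁻¹ * (ind A t x * u t x) * φ (t, x)
        - ε⁻¹ * (ind A t (x - ξ) * u t (x - ξ)) * φ (t, x)) =
      -inner ℝ (u t) (sliceL2 h.timeDeriv.continuous t)
        - ν * inner ℝ (u t) (sliceL2 h.laplacian_continuous t)
        - inner ℝ (source ε⁻¹ ξ hA' t (u t)) (sliceL2 h.continuous t) := by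
  filter_upwards [Measure.ae_ae_of_ae_prod hAA'] with t ht
  have hind : ∀ᵐ x : Torus d, ind A t x = ind A' t x := by
    filter_upwards [ht] with x hx
    have hx' : ((t, x) ∈ A') = ((t, x) ∈ A) := hx
    by_cases hm : (t, x) ∈ A
    · simp [ind, hm, hx'.mpr hm]
    · have : (t, x) ∉ A' := fun h => hm (hx'.mp h)
      simp [ind, hm, this]
  have hint : ∀ (w : L2 d) {ψ : ℝ × Torus d → ℝ} (_ : Continuous ψ),
      Integrable fun x => w x * ψ (t, x) := fun w ψ hψ =>
    integrable_mul_of_continuous w (hψ.comp (Continuous.prodMk_right t))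
  have i1 : Integrable fun x => -(u t x * deriv (fun s => φ (s, x)) t) :=
    (hint (u t) h.timeDeriv.continuous).neg
  have i2 : Integrable fun x => ν * (u t x * laplacian (fun z => φ (t, z)) x) :=
    (hint (u t) h.laplacian_continuous).const_mul ν
  have i3 : Integrable fun x => -(u t x * deriv (fun s => φ (s, x)) t) -
      ν * (u t x * laplacian (fun z => φ (t, z)) x) := i1.sub i2
  rw [inner_sliceL2, inner_sliceL2, inner_sliceL2, ← integral_neg, ← integral_const_mul,
    ← integral_sub i1 i2, ← integral_sub i3 (hint _ h.continuous)]
  refine integral_congr_ae ?_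
  filter_upwards [hind, ae_shift hind (-ξ), source_coe ε⁻¹ ξ hA' t (u t)] with x h1 h2 h3
  have hx : -ξ + x = x - ξ := by abel
  rw [hx] at h2
  simp only [h3, h1, h2]
  ring

lemma solvesPenalized_iff {d : ℕ} {T ν ε : ℝ} {ξ : Torus d} {A A' : Set (ℝ × Torus d)}
    (hA' : MeasurableSet A') (hAA' : A' =ᵐ[(timeMeasure T).prod volume] A)
    (m : L2Time T (H1 d)) {c : ℝ → L2 d} (hc : ∀ᵐ t ∂timeMeasure T, c t = toL2 d (m t)) :
    SolvesPenalized ν ε ξ A m ↔ ∀ (φ : ℝ × Torus d → ℝ) (h : IsTest T φ),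
      ∫ t, (-inner ℝ (c t) (sliceL2 h.smooth.timeDeriv.continuous t)
        - ν * inner ℝ (c t) (sliceL2 h.smooth.laplacian_continuous t)
        - inner ℝ (source ε⁻¹ ξ hA' t (c t)) (sliceL2 h.smooth.continuous t)) ∂timeMeasure T =
        0 := by
  refine forall_congr' fun φ => forall_congr' fun h => ?_
  have e := ae_integral_eq (ν := ν) (ε := ε) (ξ := ξ) hA' hAA' (fun t => toL2 d (m t)) h.smooth
  rw [integral_congr_ae e]
  refine Eq.congr (integral_congr_ae ?_) rfl
  filter_upwards [hc] with t ht
  rw [ht]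

/-! ### Coordinates of solutions -/

lemma L2_ext {d : ℕ} {u v : L2 d} (h : ∀ k, inner ℝ u (casL2 k) = inner ℝ v (casL2 k)) :
    u = v := by
  refine sub_eq_zero.1 (eq_zero_of_inner_casL2 _ fun k => ?_)
  rw [inner_sub_left, h, sub_self]

/-- The Hartley coordinates `n_k` of `n` satisfy `n_k' = -(ν λ_k + a) n_k + (B n)_k` on `[0,T]`,
i.e. `n` solves `∂_t n = νΔn - a n + B n` mode by mode. -/
def SolvesModes {d : ℕ} (T ν a : ℝ) (B : ℝ → L2 d →L[ℝ] L2 d) (n : ℝ → L2 d) : Prop :=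
  ∀ k, IsPrimitive T (fun t => inner ℝ (n t) (casL2 k))
    (fun t => -(ν * eigenvalue k + a) * inner ℝ (n t) (casL2 k) +
      inner ℝ (B t (n t)) (casL2 k))

section modes

variable {d : ℕ} {T ν a : ℝ} {B : ℝ → L2 d →L[ℝ] L2 d} {n : ℝ → L2 d}

section dual

variable {E V : Type*} [NormedAddCommGroup E] [NormedSpace ℝ E] [NormedAddCommGroup V]
  [NormedSpace ℝ V]

/-- Composition with a continuous linear map into a dual space preserves `L²`. -/
lemma memLp_dual_comp (L : E →L[ℝ] StrongDual ℝ V) {f : ℝ → E}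
    (hf : MemLp f 2 (timeMeasure T)) : MemLp (fun t => L (f t)) 2 (timeMeasure T) :=
  L.comp_memLp' hf

lemma memLp_dual_neg_smul_add {F G : ℝ → StrongDual ℝ V} (r : ℝ)
    (hF : MemLp F 2 (timeMeasure T)) (hG : MemLp G 2 (timeMeasure T)) :
    MemLp (fun t => -(r • F t) + G t) 2 (timeMeasure T) :=
  (hF.const_smul r).neg.add hG

lemma integral_smul_dual_apply {g : ℝ → ℝ} {F : ℝ → StrongDual ℝ V} (hg : Continuous g)
    (hF : MemLp F 2 (timeMeasure T)) (z : V) :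
    (∫ t, g t • F t ∂timeMeasure T) z = ∫ t, g t * F t z ∂timeMeasure T :=
  ContinuousLinearMap.integral_apply
    (memLp_one_iff_integrable.1 (hF.smul (memLp_of_continuousOn hg.continuousOn))) z

/-- An `L²` family of functionals has a class in `L²((0,T), V*)`, whose weighted time integrals
are computed pointwise. -/
lemma exists_L2Time_dual {F : ℝ → StrongDual ℝ V} (hF : MemLp F 2 (timeMeasure T)) :
    ∃ w : L2Time T (StrongDual ℝ V), ∀ {g : ℝ → ℝ}, Continuous g → ∀ z : V,
      (∫ t, g t • w t ∂timeMeasure T) z = ∫ t, g t * F t z ∂timeMeasure T := by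
  refine ⟨hF.toLp, fun hg z => ?_⟩
  rw [integral_smul_dual_apply hg (Lp.memLp _)]
  refine integral_congr_ae ?_
  filter_upwards [hF.coeFn_toLp] with t ht
  rw [ht]

end dual

lemma continuousOn_coord (hn : ContinuousOn n (Icc 0 T)) (k : Fin d → ℤ) :
    ContinuousOn (fun t => inner ℝ (n t) (casL2 k)) (Icc 0 T) :=
  hn.inner continuousOn_const

/-- An exponential factor in time shifts the damping coefficient. -/
lemma SolvesModes.exp_smul (hT : 0 ≤ T) (h : SolvesModes T ν a B n)
    (hn : ContinuousOn n (Icc 0 T)) (hBn : MemLp (fun s => B s (n s)) 2 (timeMeasure T)) (r : ℝ) :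
    SolvesModes T ν (a - r) B (fun t => Real.exp (r * t) • n t) := by
  intro k
  have hg : IntervalIntegrable (fun t => -(ν * eigenvalue k + a) * inner ℝ (n t) (casL2 k) +
      inner ℝ (B t (n t)) (casL2 k)) volume 0 T := by
    rw [intervalIntegrable_iff_timeMeasure hT]
    exact ((integrable_timeMeasure_of_continuousOn (continuousOn_coord hn k)).const_mul _).add
      ((memLp_inner_const hBn (casL2 k)).integrable one_le_two)
  refine ((h k).exp_mul hg r).congr hT (fun t _ => ?_) (Eventually.of_forall fun t _ => ?_)
  · rw [real_inner_smul_left]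
  · rw [map_smul, real_inner_smul_left, real_inner_smul_left]
    ring

/-- Duhamel's formula is equivalent to the system of equations for the coordinates. -/
lemma eq_picard_iff (hT : 0 ≤ T) (hν : 0 ≤ ν) (ha : 0 ≤ a) {u₀ : L2 d}
    (hn : ContinuousOn n (Icc 0 T)) {C : ℝ} (hBm : AEStronglyMeasurable (fun s => B s (n s))
      (timeMeasure T)) (hC : ∀ᵐ s ∂timeMeasure T, ‖B s (n s)‖ ≤ C) :
    (∀ t ∈ Icc 0 T, n t = picard T ν a B u₀ n t) ↔ SolvesModes T ν a B n ∧ n 0 = u₀ := by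
  have hBn := memLp_of_bound_timeMeasure hBm hC
  have hp : ∀ t ∈ Icc 0 T, ∀ k, inner ℝ (picard T ν a B u₀ n t) (casL2 k) =
      Real.exp (-((ν * eigenvalue k + a) * t)) * inner ℝ u₀ (casL2 k) +
        ∫ s in 0..t, Real.exp (-((ν * eigenvalue k + a) * (t - s))) *
          inner ℝ (B s (n s)) (casL2 k) := by
    intro t ht k
    rw [picard, inner_add_left, real_inner_smul_left, inner_heat_casL2 (mul_nonneg hν ht.1),
      inner_duhamel_casL2 hν ha hBm hC k ht, ← mul_assoc, ← Real.exp_add]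
    congr 3
    ring
  have hmild : ∀ k, IsPrimitive T (fun t => inner ℝ (n t) (casL2 k))
      (fun t => -(ν * eigenvalue k + a) * inner ℝ (n t) (casL2 k) +
        inner ℝ (B t (n t)) (casL2 k)) ↔ _ := fun k =>
    isPrimitive_iff_mild hT (continuousOn_coord hn k)
      ((memLp_inner_const hBn (casL2 k)).integrable one_le_two)
  constructor
  · intro h
    have h0 : n 0 = u₀ := by
      refine L2_ext fun k => ?_
      rw [h 0 (left_mem_Icc.2 hT), hp 0 (left_mem_Icc.2 hT)]
      simp
    refine ⟨fun k => (hmild k).2 fun t ht => ?_, h0⟩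
    rw [h0, ← hp t ht k, ← h t ht]
  · rintro ⟨h, h0⟩ t ht
    refine L2_ext fun k => ?_
    rw [hp t ht k, ← h0]
    exact (hmild k).1 (h k) t ht

/-- The energy estimate, summed over the modes, gives `L²((0,T), H¹)` regularity. -/
lemma SolvesModes.summable (hT : 0 ≤ T) (hν : 0 < ν) (ha : 0 ≤ a) (h : SolvesModes T ν a B n)
    (hn : ContinuousOn n (Icc 0 T)) (hBn : MemLp (fun s => B s (n s)) 2 (timeMeasure T)) :
    Summable fun k =>
      (1 + eigenvalue k) * ∫ t, inner ℝ (n t) (casL2 k) ^ 2 ∂timeMeasure T := by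
  have hn2 := memLp_of_continuousOn hn
  have s0 : Summable fun k : Fin d → ℤ => inner ℝ (n 0) (casL2 k) ^ 2 := by
    have := (orthonormal_casL2 d).inner_products_summable (n 0)
    simpa only [Real.norm_eq_abs, sq_abs, real_inner_comm] using this
  have s1 := summable_integral_coord_sq (hartley d) hn2
  have s2 := summable_integral_coord_sq (hartley d) hBn
  simp only [hartley_apply] at s1 s2
  refine Summable.of_nonneg_of_le (fun k => mul_nonneg (one_add_eigenvalue_pos k).le
    (integral_nonneg fun t => sq_nonneg _)) (fun k => ?_)
    (s1.add (((s0.add s1).add s2).mul_left (1 / (2 * ν))))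
  have hE := (h k).energy hT (continuousOn_coord hn k)
    ((memLp_inner_const hBn (casL2 k)).integrable one_le_two)
    (memLp_inner_const hBn (casL2 k)).integrable_sq
  have hI : 0 ≤ ∫ t, inner ℝ (n t) (casL2 k) ^ 2 ∂timeMeasure T :=
    integral_nonneg fun t => sq_nonneg _
  set I := ∫ t, inner ℝ (n t) (casL2 k) ^ 2 ∂timeMeasure T with hIdef
  set J := ∫ t, inner ℝ (B t (n t)) (casL2 k) ^ 2 ∂timeMeasure T
  have h1 : eigenvalue k * I ≤ 1 / (2 * ν) * (inner ℝ (n 0) (casL2 k) ^ 2 + I + J) := by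
    rw [one_div_mul_eq_div, le_div_iff₀ (by positivity)]
    nlinarith [mul_nonneg ha hI]
  calc (1 + eigenvalue k) * I = I + eigenvalue k * I := by ring
    _ ≤ _ := add_le_add le_rfl h1

/-- If the coordinates of `n` satisfy their equations and `m` is the lift of `n` to `H¹`, then
`∂_t m = νΔm - a n + B n` belongs to `L²((0,T), H⁻¹)`. -/
lemma SolvesModes.mem_parabolicSpace (hT : 0 ≤ T) (h : SolvesModes T ν a B n)
    (hn : ContinuousOn n (Icc 0 T)) (hBn : MemLp (fun s => B s (n s)) 2 (timeMeasure T))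
    {m : L2Time T (H1 d)} (hm : ∀ᵐ t ∂timeMeasure T, n t = toL2 d (m t)) :
    m ∈ parabolicSpace d T := by
  have hn2 := memLp_of_continuousOn hn
  have hw : MemLp (fun t => -(ν • negLaplacian d (m t)) + ofL2 d (B t (n t) - a • n t)) 2
      (timeMeasure T) := by
    have a1 : MemLp (fun t => negLaplacian d (m t)) 2 (timeMeasure T) :=
      memLp_dual_comp (V := H1 d) (negLaplacian d) (Lp.memLp m)
    have a2 : MemLp (fun t => ofL2 d (B t (n t) - a • n t)) 2 (timeMeasure T) :=
      memLp_dual_comp (V := H1 d) (ofL2 d) (hBn.sub (hn2.const_smul a))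
    exact memLp_dual_neg_smul_add (V := H1 d) ν a1 a2
  obtain ⟨w, hw'⟩ := exists_L2Time_dual (V := H1 d) hw
  refine ⟨w, fun θ hθ => ?_⟩
  have hθ1 : ContDiff ℝ 1 θ := hθ.1.of_le (by simp)
  have h0 : θ 0 = 0 := image_eq_zero_of_notMem_tsupport fun h => lt_irrefl _ (hθ.2.2 h).1
  have h1 : θ T = 0 := image_eq_zero_of_notMem_tsupport fun h => lt_irrefl _ (hθ.2.2 h).2
  have hu : MemLp (fun t => toHneg1 (m t)) 2 (timeMeasure T) :=
    memLp_dual_comp (V := H1 d) ((ofL2 d).comp (toL2 d)) (Lp.memLp m)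
  refine Hneg1_ext fun k => ?_
  have d1 := integral_smul_dual_apply (V := H1 d) (hθ1.continuous_deriv le_rfl) hu (casH1 k)
  refine d1.trans (Eq.trans ?_ (congrArg Neg.neg (hw' hθ1.continuous (casH1 k))).symm)
  have hg : Integrable (fun t => -(ν * eigenvalue k + a) * inner ℝ (n t) (casL2 k) +
      inner ℝ (B t (n t)) (casL2 k)) (timeMeasure T) :=
    ((integrable_timeMeasure_of_continuousOn (continuousOn_coord hn k)).const_mul _).add
      ((memLp_inner_const hBn (casL2 k)).integrable one_le_two)
  have key := (h k).integral_deriv_mul hT hg hθ1 h0 h1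
  have e1 : ∫ t, deriv θ t * toHneg1 (m t) (casH1 k) ∂timeMeasure T =
      ∫ t, deriv θ t * inner ℝ (n t) (casL2 k) ∂timeMeasure T := by
    refine integral_congr_ae ?_
    filter_upwards [hm] with t ht
    rw [toHneg1_eq, ofL2_apply, toL2_casH1, ← ht]
  have e2 : ∫ t, θ t * (-(ν • negLaplacian d (m t)) + ofL2 d (B t (n t) - a • n t)) (casH1 k)
      ∂timeMeasure T =
      ∫ t, θ t * (-(ν * eigenvalue k + a) * inner ℝ (n t) (casL2 k) +
        inner ℝ (B t (n t)) (casL2 k)) ∂timeMeasure T := by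
    refine integral_congr_ae ?_
    filter_upwards [hm] with t ht
    rw [add_apply,
      neg_apply, smul_apply, negLaplacian_casH1,
      ofL2_apply, toL2_casH1, inner_sub_left, real_inner_smul_left, ← ht, smul_eq_mul]
    ring
  rw [e1, e2, key]

end modes

/-! ### The penalized equation in coordinates -/

section penalized

variable {d : ℕ} {T ν ε : ℝ} {ξ : Torus d} {A A' : Set (ℝ × Torus d)} {c : ℝ → L2 d}

lemma memLp_jump (β : ℝ) (hβ : 0 ≤ β) (hA' : MeasurableSet A') (hc : ContinuousOn c (Icc 0 T)) :
    MemLp (fun s => jump β ξ hA' s (c s)) 2 (timeMeasure T) := by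
  obtain ⟨C, hC⟩ := exists_bound_timeMeasure (norm_jump_le hβ ξ hA') (by positivity) hc
  exact memLp_of_bound_timeMeasure (aestronglyMeasurable_jump β ξ hA'
    (aestronglyMeasurable_timeMeasure_of_continuousOn hc)) hC

lemma memLp_source (β : ℝ) (hβ : 0 ≤ β) (hA' : MeasurableSet A')
    (hc : ContinuousOn c (Icc 0 T)) :
    MemLp (fun s => source β ξ hA' s (c s)) 2 (timeMeasure T) :=
  (memLp_jump β hβ hA' hc).sub ((memLp_of_continuousOn hc).const_smul β)

lemma source_inner (β : ℝ) (hA' : MeasurableSet A') (s : ℝ) (u v : L2 d) :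
    inner ℝ (source β ξ hA' s u) v = inner ℝ (jump β ξ hA' s u) v - β * inner ℝ u v := by
  rw [source, inner_sub_left, real_inner_smul_left]

/-- A test function is expanded in the Hartley basis; each of its coordinates is a test function
in time for the equation of the corresponding mode. -/
lemma SolvesModes.integral_test (hT : 0 ≤ T) {β : ℝ} (hβ : 0 ≤ β) (hA' : MeasurableSet A')
    (hc : ContinuousOn c (Icc 0 T)) (h : SolvesModes T ν β (jump β ξ hA') c)
    {φ : ℝ × Torus d → ℝ} (hφ : IsTest T φ) :
    ∫ t, (-inner ℝ (c t) (sliceL2 hφ.smooth.timeDeriv.continuous t)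
        - ν * inner ℝ (c t) (sliceL2 hφ.smooth.laplacian_continuous t)
        - inner ℝ (source β ξ hA' t (c t)) (sliceL2 hφ.smooth.continuous t)) ∂timeMeasure T =
        0 := by
  have hc2 := memLp_of_continuousOn hc
  have hf2 := memLp_source (ξ := ξ) β hβ hA' hc
  have hB2 := memLp_jump (ξ := ξ) β hβ hA' hc
  have hV1 := memLp_sliceL2 hφ.smooth.timeDeriv.continuous T
  have hV2 := memLp_sliceL2 hφ.smooth.laplacian_continuous T
  have hV := memLp_sliceL2 hφ.smooth.continuous T
  have inner_int : ∀ {u v : ℝ → L2 d}, MemLp u 2 (timeMeasure T) → MemLp v 2 (timeMeasure T) →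
      Integrable (fun t => inner ℝ (u t) (v t)) (timeMeasure T) := by
    intro u v hu hv
    refine (hu.norm.integrable_mul hv.norm).mono (hu.aestronglyMeasurable.inner
      hv.aestronglyMeasurable) (Eventually.of_forall fun t => ?_)
    rw [Pi.mul_apply, norm_mul, norm_norm, norm_norm]
    exact norm_inner_le_norm _ _
  have i1 : Integrable (fun t => -inner ℝ (c t) (sliceL2 hφ.smooth.timeDeriv.continuous t))
      (timeMeasure T) := (inner_int hc2 hV1).neg
  have i2 : Integrable (fun t => ν * inner ℝ (c t) (sliceL2 hφ.smooth.laplacian_continuous t))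
      (timeMeasure T) := (inner_int hc2 hV2).const_mul ν
  have i3 := inner_int hf2 hV
  have e : ∫ t, (-inner ℝ (c t) (sliceL2 hφ.smooth.timeDeriv.continuous t)
        - ν * inner ℝ (c t) (sliceL2 hφ.smooth.laplacian_continuous t)
        - inner ℝ (source β ξ hA' t (c t)) (sliceL2 hφ.smooth.continuous t)) ∂timeMeasure T =
      -(∫ t, inner ℝ (c t) (sliceL2 hφ.smooth.timeDeriv.continuous t) ∂timeMeasure T)
        - ν * (∫ t, inner ℝ (c t) (sliceL2 hφ.smooth.laplacian_continuous t) ∂timeMeasure T)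
        - ∫ t, inner ℝ (source β ξ hA' t (c t)) (sliceL2 hφ.smooth.continuous t)
          ∂timeMeasure T := by
    rw [← integral_neg, ← integral_const_mul, ← integral_sub i1 i2]
    exact integral_sub (i1.sub i2) i3
  rw [e]
  have S := (((hasSum_integral_coord_mul (hartley d) hc2 hV1).neg.sub
    ((hasSum_integral_coord_mul (hartley d) hc2 hV2).mul_left ν)).sub
    (hasSum_integral_coord_mul (hartley d) hf2 hV))
  refine S.unique ?_
  have hz : ∀ k : Fin d → ℤ, -(∫ t, inner ℝ (c t) (hartley d k) *
        inner ℝ (sliceL2 hφ.smooth.timeDeriv.continuous t) (hartley d k) ∂timeMeasure T)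
      - ν * (∫ t, inner ℝ (c t) (hartley d k) *
        inner ℝ (sliceL2 hφ.smooth.laplacian_continuous t) (hartley d k) ∂timeMeasure T)
      - ∫ t, inner ℝ (source β ξ hA' t (c t)) (hartley d k) *
        inner ℝ (sliceL2 hφ.smooth.continuous t) (hartley d k) ∂timeMeasure T = 0 := by
    intro k
    simp only [hartley_apply]
    set θ : ℝ → ℝ := fun t => inner ℝ (sliceL2 hφ.smooth.continuous t) (casL2 k) with hθ
    have hd : deriv θ = fun t => inner ℝ (sliceL2 hφ.smooth.timeDeriv.continuous t) (casL2 k) :=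
      funext fun t => (hφ.hasDerivAt_coord k t).deriv
    have hθ1 : ContDiff ℝ 1 θ := by
      rw [contDiff_one_iff_deriv]
      refine ⟨fun t => (hφ.hasDerivAt_coord k t).differentiableAt, ?_⟩
      rw [hd]
      exact (continuous_sliceL2 _).inner continuous_const
    have hθz : ∀ t, t ∉ Ioo 0 T → θ t = 0 := by
      intro t ht
      simp only [hθ, inner_sliceL2_casL2, hφ.eq_zero ht, zero_mul, integral_zero]
    have ck := continuousOn_coord hc k
    have cki := integrable_timeMeasure_of_continuousOn ck
    have hBk := (memLp_inner_const hB2 (casL2 k)).integrable one_le_two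
    have key := (h k).integral_deriv_mul hT ((cki.const_mul _).add hBk) hθ1
      (hθz 0 fun h => lt_irrefl _ h.1) (hθz T fun h => lt_irrefl _ h.2)
    have j1 : Integrable (fun t => θ t * inner ℝ (c t) (casL2 k)) (timeMeasure T) :=
      integrable_timeMeasure_of_continuousOn (hθ1.continuous.continuousOn.mul ck)
    have j2 : Integrable (fun t => θ t * inner ℝ (jump β ξ hA' t (c t)) (casL2 k))
        (timeMeasure T) :=
      (memLp_of_continuousOn hθ1.continuous.continuousOn).integrable_mul
        (memLp_inner_const hB2 (casL2 k))
    have k1 : ∫ t, θ t * (-(ν * eigenvalue k + β) * inner ℝ (c t) (casL2 k) +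
        inner ℝ (jump β ξ hA' t (c t)) (casL2 k)) ∂timeMeasure T =
        -(ν * eigenvalue k + β) * (∫ t, θ t * inner ℝ (c t) (casL2 k) ∂timeMeasure T) +
        ∫ t, θ t * inner ℝ (jump β ξ hA' t (c t)) (casL2 k) ∂timeMeasure T := by
      rw [← integral_const_mul, ← integral_add (j1.const_mul _) j2]
      exact integral_congr_ae (Eventually.of_forall fun t => by ring)
    have k2 : ∫ t, inner ℝ (source β ξ hA' t (c t)) (casL2 k) * θ t ∂timeMeasure T =
        (∫ t, θ t * inner ℝ (jump β ξ hA' t (c t)) (casL2 k) ∂timeMeasure T) -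
        β * ∫ t, θ t * inner ℝ (c t) (casL2 k) ∂timeMeasure T := by
      rw [← integral_const_mul, ← integral_sub j2 (j1.const_mul _)]
      exact integral_congr_ae (Eventually.of_forall fun t => by
        simp only [source_inner]; ring)
    have k3 : ∫ t, inner ℝ (c t) (casL2 k) *
        inner ℝ (sliceL2 hφ.smooth.laplacian_continuous t) (casL2 k) ∂timeMeasure T =
        -eigenvalue k * ∫ t, θ t * inner ℝ (c t) (casL2 k) ∂timeMeasure T := by
      rw [← integral_const_mul]
      refine integral_congr_ae (Eventually.of_forall fun t => ?_)
      simp only [hθ, inner_laplacian_casL2 hφ.smooth k t]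
      ring
    have k4 : ∫ t, inner ℝ (c t) (casL2 k) *
        inner ℝ (sliceL2 hφ.smooth.timeDeriv.continuous t) (casL2 k) ∂timeMeasure T =
        ∫ t, deriv θ t * inner ℝ (c t) (casL2 k) ∂timeMeasure T := by
      rw [hd]
      exact integral_congr_ae (Eventually.of_forall fun t => mul_comm _ _)
    rw [k4, k3, k2, key, k1]
    ring
  simp only [hz]
  exact hasSum_zero

lemma isTest_mul_cas {θ : ℝ → ℝ} (hθ : IsTimeTest T θ) (k : Fin d → ℤ) :
    IsTest T fun p : ℝ × Torus d => θ p.1 * cas k p.2 := by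
  have hsub : tsupport (fun p : ℝ × Torus d => θ p.1 * cas k p.2) ⊆ tsupport θ ×ˢ univ := by
    refine closure_minimal (fun p hp => ⟨subset_tsupport _ fun h => hp ?_, mem_univ _⟩)
      ((isClosed_tsupport θ).prod isClosed_univ)
    simp only [h, zero_mul]
  refine ⟨?_, ?_, hsub.trans (prod_mono hθ.2.2 subset_rfl)⟩
  · exact (hθ.1.comp contDiff_fst).mul (ContDiff.comp (g := fun y : Fin d → ℝ => cas k (proj y))
      (cas_smooth k) contDiff_snd)
  · exact HasCompactSupport.of_support_subset_isCompact (hθ.2.1.isCompact.prod isCompact_univ)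
      ((subset_tsupport _).trans hsub)

/-- Testing the equation with the products `θ(t) cas_k(x)` gives the equations of the modes. -/
lemma solvesModes_of_integral_test (hT : 0 < T) {β : ℝ} (hβ : 0 ≤ β) (hA' : MeasurableSet A')
    (hc : ContinuousOn c (Icc 0 T))
    (h : ∀ (φ : ℝ × Torus d → ℝ) (hφ : IsTest T φ),
      ∫ t, (-inner ℝ (c t) (sliceL2 hφ.smooth.timeDeriv.continuous t)
        - ν * inner ℝ (c t) (sliceL2 hφ.smooth.laplacian_continuous t)
        - inner ℝ (source β ξ hA' t (c t)) (sliceL2 hφ.smooth.continuous t)) ∂timeMeasure T = 0) :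
    SolvesModes T ν β (jump β ξ hA') c := by
  intro k
  have hB2 := memLp_jump (ξ := ξ) β hβ hA' hc
  have ck := continuousOn_coord hc k
  have cki := integrable_timeMeasure_of_continuousOn ck
  have hBk := (memLp_inner_const hB2 (casL2 k)).integrable one_le_two
  refine isPrimitive_of_weak hT ck ((cki.const_mul _).add hBk) fun θ hθ => ?_
  have hφ := isTest_mul_cas hθ k
  have hθ1 : ContDiff ℝ 1 θ := hθ.1.of_le (by simp)
  have e1 : ∀ t, inner ℝ (c t) (sliceL2 hφ.smooth.timeDeriv.continuous t) =
      deriv θ t * inner ℝ (c t) (casL2 k) := by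
    intro t
    rw [inner_sliceL2, inner_casL2, ← integral_const_mul]
    refine integral_congr_ae (Eventually.of_forall fun x => ?_)
    simp only [deriv_mul_const_field]
    ring
  have e3 : ∀ t (u : L2 d), inner ℝ u (sliceL2 hφ.smooth.continuous t) =
      θ t * inner ℝ u (casL2 k) := by
    intro t u
    rw [inner_sliceL2, inner_casL2, ← integral_const_mul]
    refine integral_congr_ae (Eventually.of_forall fun x => ?_)
    ring
  have e2 : ∀ t, inner ℝ (c t) (sliceL2 hφ.smooth.laplacian_continuous t) =
      -eigenvalue k * (θ t * inner ℝ (c t) (casL2 k)) := by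
    intro t
    rw [inner_sliceL2, inner_casL2, ← integral_const_mul, ← integral_const_mul]
    refine integral_congr_ae (Eventually.of_forall fun x => ?_)
    have : laplacian (fun x : Torus d => θ t * cas k x) x = θ t * laplacian (cas k) x := by
      simp only [laplacian, partialDeriv_const_mul, Finset.mul_sum]
    simp only [this, laplacian_cas]
    ring
  have h1 := h _ hφ
  simp only [e1, e2, e3, source_inner] at h1
  have j0 : Integrable (fun t => deriv θ t * inner ℝ (c t) (casL2 k)) (timeMeasure T) :=
    integrable_timeMeasure_of_continuousOn ((hθ1.continuous_deriv le_rfl).continuousOn.mul ck)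
  have j1 : Integrable (fun t => θ t * inner ℝ (c t) (casL2 k)) (timeMeasure T) :=
    integrable_timeMeasure_of_continuousOn (hθ1.continuous.continuousOn.mul ck)
  have j2 : Integrable (fun t => θ t * inner ℝ (jump β ξ hA' t (c t)) (casL2 k))
      (timeMeasure T) :=
    (memLp_of_continuousOn hθ1.continuous.continuousOn).integrable_mul
      (memLp_inner_const hB2 (casL2 k))
  have j3 : Integrable (fun t => θ t * (-(ν * eigenvalue k + β) * inner ℝ (c t) (casL2 k) +
      inner ℝ (jump β ξ hA' t (c t)) (casL2 k))) (timeMeasure T) :=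
    ((j1.const_mul (-(ν * eigenvalue k + β))).add j2).congr
      (Eventually.of_forall fun t => by simp only [Pi.add_apply]; ring)
  rw [← add_eq_zero_iff_eq_neg, ← integral_add j0 j3, ← neg_eq_zero, ← integral_neg, ← h1]
  exact integral_congr_ae (Eventually.of_forall fun t => by ring)

end penalized

/-- The penalized problem has a unique solution, and it is nonnegative.  Existence and uniqueness
of the continuous representative `c` come from the contraction `picard` for `exp (-3βt) c`, where
`β = ε⁻¹`: the damping `4β` exceeds the bound `3β` of `jump β`. -/
lemma exists_unique_nonneg {d : ℕ} {T ν ε : ℝ} (hT : 0 < T) (hν : 0 < ν) (hε : 0 < ε)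
    (ξ : Torus d) {A : Set (ℝ × Torus d)}
    (hA : NullMeasurableSet A ((timeMeasure T).prod (volume : Measure (Torus d))))
    {m₀ : L2 d} (hm₀ : 0 ≤ m₀) :
    ∃ m : L2Time T (H1 d), IsPenalizedSolution ν ε ξ A m₀ m ∧
      (∀ᵐ t ∂timeMeasure T, 0 ≤ toL2 d (m t)) ∧
      ∀ m' : L2Time T (H1 d), IsPenalizedSolution ν ε ξ A m₀ m' → m' = m := by
  -- `jump` needs measurable time slices
  obtain ⟨A', -, hA', hAA'⟩ := hA.exists_measurable_superset_ae_eq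
  set β := ε⁻¹ with hβdef
  have hβ : 0 < β := inv_pos.2 hε
  have hBm : ∀ c : ℝ → L2 d, AEStronglyMeasurable c (timeMeasure T) →
      AEStronglyMeasurable (fun s => jump β ξ hA' s (c s)) (timeMeasure T) :=
    fun c hc => aestronglyMeasurable_jump β ξ hA' hc
  have hexp : ∀ (r : ℝ) {c : ℝ → L2 d}, ContinuousOn c (Icc 0 T) →
      ContinuousOn (fun t => Real.exp (r * t) • c t) (Icc 0 T) := fun r c hc => by
    have : Continuous fun t : ℝ => Real.exp (r * t) := by fun_prop
    exact this.continuousOn.smul hc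
  have hiff : ∀ n : ℝ → L2 d, ContinuousOn n (Icc 0 T) →
      ((∀ t ∈ Icc 0 T, n t = picard T ν (4 * β) (jump β ξ hA') m₀ n t) ↔
        SolvesModes T ν (4 * β) (jump β ξ hA') n ∧ n 0 = m₀) := by
    intro n hn
    obtain ⟨C, hC⟩ := exists_bound_timeMeasure (norm_jump_le hβ.le ξ hA') (by positivity) hn
    exact eq_picard_iff hT.le hν.le (by positivity) hn
      (hBm n (aestronglyMeasurable_timeMeasure_of_continuousOn hn)) hC
  obtain ⟨n, hn, hfix, hpos, huniq⟩ := exists_unique_picard (ν := ν) (κ := 4 * β) hT.le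
    (by positivity) (by linarith) (norm_jump_le hβ.le ξ hA') hBm
    (fun s u hu => jump_nonneg hβ.le ξ hA' s hu) hm₀
  obtain ⟨hmodes, hn0⟩ := (hiff n hn).1 hfix
  set c : ℝ → L2 d := fun t => Real.exp (3 * β * t) • n t with hcdef
  have hc : ContinuousOn c (Icc 0 T) := hexp _ hn
  have hcm : SolvesModes T ν β (jump β ξ hA') c := by
    have := hmodes.exp_smul hT.le hn (memLp_jump β hβ.le hA' hn) (3 * β)
    rwa [show 4 * β - 3 * β = β by ring] at this
  have hB2 := memLp_jump (ξ := ξ) β hβ.le hA' hc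
  obtain ⟨m, hm⟩ := exists_lift_H1 (memLp_of_continuousOn hc)
    (hcm.summable hT.le hν hβ.le hc hB2)
  have hm' : ∀ᵐ t ∂timeMeasure T, c t = toL2 d (m t) := hm.mono fun t ht => ht.symm
  refine ⟨m, ⟨hcm.mem_parabolicSpace hT.le hc hB2 hm', ?_, c, hc, hm', ?_⟩, ?_, ?_⟩
  · exact (solvesPenalized_iff hA' hAA' m hm').2 fun φ hφ =>
      hcm.integral_test hT.le hβ.le hA' hc hφ
  · simp [hcdef, hn0]
  · filter_upwards [hm, ae_restrict_mem measurableSet_Ioo] with t ht ht'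
    rw [ht]
    exact smul_nonneg_L2 (Real.exp_nonneg _) (hpos t (Ioo_subset_Icc_self ht'))
  · rintro m' ⟨-, hsol, c', hc', hcm', hc0⟩
    have hmodes' := solvesModes_of_integral_test hT hβ.le hA' hc'
      ((solvesPenalized_iff hA' hAA' m' hcm').1 hsol)
    have h1 := hmodes'.exp_smul hT.le hc' (memLp_jump β hβ.le hA' hc') (-(3 * β))
    rw [show β - -(3 * β) = 4 * β by ring] at h1
    have h2 := huniq _ (hexp (-(3 * β)) hc') ((hiff _ (hexp (-(3 * β)) hc')).2 ⟨h1, by simp [hc0]⟩)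
    refine Lp.ext ?_
    filter_upwards [hm, hcm', ae_restrict_mem measurableSet_Ioo] with t e1 e2 ht
    apply toL2_injective
    rw [e1, ← e2, hcdef]
    simp only
    rw [← h2 (Ioo_subset_Icc_self ht), smul_smul, ← Real.exp_add]
    simp

end JumpFP

end

theorem mainTheorem5 (d : ℕ) (T ν ε : ℝ) (hT : 0 < T) (hν : 0 < ν) (hε : 0 < ε)
    (ξ : JumpFP.Torus d) (A : Set (ℝ × JumpFP.Torus d))
    (hA : MeasureTheory.NullMeasurableSet A
      ((JumpFP.timeMeasure T).prod (MeasureTheory.volume : MeasureTheory.Measure (JumpFP.Torus d))))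
    (m₀ : JumpFP.L2 d) (hm₀ : 0 ≤ m₀) :
    (∃! m : JumpFP.L2Time T (JumpFP.H1 d), JumpFP.IsPenalizedSolution ν ε ξ A m₀ m) ∧
      ∀ m : JumpFP.L2Time T (JumpFP.H1 d), JumpFP.IsPenalizedSolution ν ε ξ A m₀ m →
        ∀ᵐ t ∂(JumpFP.timeMeasure T), ∀ᵐ x : JumpFP.Torus d, 0 ≤ JumpFP.toL2 d (m t) x := by
  obtain ⟨m, hm, hpos, huniq⟩ := JumpFP.exists_unique_nonneg hT hν hε ξ hA hm₀
  refine ⟨⟨m, hm, huniq⟩, fun m' hm' => ?_⟩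
  rw [huniq m' hm']
  filter_upwards [hpos] with t ht
  exact (JumpFP.nonneg_iff _).1 ht
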